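/- Let $L(sl_2)=\mathbb{C}[t,t^{-1}]\otimes sl_2(\mathbb{C})$ be the $sl_2$ loop algebra, with $x_k^{+}=t^k\otimes e$, $x_k^{-}=t^k\otimes f$, $h_k=t^k\otimes h$ ($k\in\mathbb{Z}$), so that $[h_j,x_k^{\pm}]=\pm 2x_{j+k}^{\pm}$, $[x_j^{+},x_k^{-}]=h_{j+k}$, $[h_j,h_k]=[x_j^{\pm},x_k^{\pm}]=0$. Write $X^{(n)}=X^n/n!$. For a collection $A=\{\alpha_1,\dots,\alpha_m\}$ of $m$ complex parameters (repetitions allowed) put $$x_m^{-}(A)=\sum_{k=0}^{m}(-1)^k\Big(\sum_{i_1<\dots<i_k}\alpha_{i_1}\cdots\alpha_{i_k}\Big)x_{m-k}^{-}.$$ Let $\Omega$ be a highest weight vector in a complex representation of $L(sl_2)$, i.e. $\Omega\neq 0$, $x_k^{+}\Omega=0$ and $h_k\Omega\in\mathbb{C}\Omega$ for all $k\in\mathbb{Z}$, and assume that the subrepresentation $V_\Omega$ generated by $\Omega$ is finite-dimensional. Then $h_0\Omega=r\Omega$ for an integer $r\ge 0$; for $0\le k\le r$ there are scalars $\lambda_k$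 with $(x_0^{+})^{(k)}(x_1^{-})^{(k)}\Omega=\lambda_k\Omega$; and the polynomial $P_\Omega(u)=\sum_{k=0}^{r}\lambda_k(-u)^k$ has degree $r$. Write $P_\Omega(u)=\prod_{k=1}^{s}(1-a_ku)^{m_k}$ with $a_1,\dots,a_s$ nonzero and pairwise distinct and $m_k\ge 1$; the $a_k$ are the evaluation parameters of $\Omega$, with multiplicities $m_k$. Assume that the evaluation parameters counted with multiplicity are distinct, i.e. $m_k=1$ for all $k$. Put $\boldsymbol a=\{a_1,\dots,a_s\}$ and $\rho_j(\boldsymbol a)=x_{s-1}^{-}(\boldsymbol a\setminus\{a_j\})$ for $1\le j\le s$. Then for every integer $n\ge 0$ the vectors $$\rho_{j_1}(\boldsymbol a)\cdots\rho_{j_n}(\boldsymbol a)\,\Omega,\qquad 1\le j_1<\cdots<j_n\le s,$$ form a basis of the sector $\{v\in V_\Omega : h_0v=(r-2n)v\}$, while the vectors $\rho_{j_1}(\boldsymbol a)\cdots\rho_{j_n}(\boldsymbol a)\,\Omega$ with $1\le j_1\le\cdots\le j_n\le s$ in which some index is repeated are all zero. -/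

import Mathlib

noncomputable section

namespace SlTwoLoop

open scoped TensorProduct
open LieAlgebra

/-- The Lie algebra `sl₂(ℂ)` of traceless `2 × 2` complex matrices. -/
abbrev SlTwo : Type := SpecialLinear.sl (Fin 2) ℂ

/-- The `sl₂` loop algebra `L(sl₂) = ℂ[t, t⁻¹] ⊗ sl₂(ℂ)`. -/
abbrev L : Type := loopAlgebra ℂ ℤ SlTwo

/-- The element `t ^ k ⊗ y` of the loop algebra. -/
def mode (k : ℤ) (y : SlTwo) : L := AddMonoidAlgebra.single k (1 : ℂ) ⊗ₜ[ℂ] y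

/-- `x_k⁺ = t ^ k ⊗ e`, with `e` the matrix unit `E₁₂`. -/
def xPos (k : ℤ) : L := mode k (SpecialLinear.single 0 1 zero_ne_one 1)

/-- `x_k⁻ = t ^ k ⊗ f`, with `f` the matrix unit `E₂₁`. -/
def xNeg (k : ℤ) : L := mode k (SpecialLinear.single 1 0 one_ne_zero 1)

/-- `h_k = t ^ k ⊗ (E₁₁ - E₂₂)`. -/
def hCartan (k : ℤ) : L := mode k (SpecialLinear.singleSubSingle 0 1 1)

/-- The generator with parameters `x_m⁻(A) = ∑_{k=0}^m (-1)^k e_k(A) x_{m-k}⁻`, for a collection `A`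
of `m` parameters (with repetitions allowed), `e_k` being the elementary symmetric function. -/
def xNegParam (A : Multiset ℂ) : L :=
  ∑ k ∈ Finset.range (Multiset.card A + 1),
    ((-1 : ℂ) ^ k * A.esymm k) • xNeg ((Multiset.card A : ℤ) - (k : ℤ))

/-- `ρ_j(a) = x_{s-1}⁻(a ∖ {a_j})`, for a family `a` of `s` parameters. -/
def rho {s : ℕ} (a : Fin s → ℂ) (j : Fin s) : L :=
  xNegParam ((Finset.univ.erase j).val.map a)

variable {V : Type*} [AddCommGroup V] [Module ℂ V] [LieRingModule L V] [LieModule ℂ L V]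

/-- A highest weight vector: nonzero, annihilated by all `x_k⁺`, and a simultaneous eigenvector of
all `h_k`. -/
structure IsHighestWeightVector (Ω : V) : Prop where
  ne_zero : Ω ≠ 0
  annihilated : ∀ k : ℤ, ⁅xPos k, Ω⁆ = 0
  eigenvector : ∀ k : ℤ, ∃ d : ℂ, ⁅hCartan k, Ω⁆ = d • Ω

/-- The representation `V_Ω` generated by `Ω`. -/
def generatedRep (Ω : V) : LieSubmodule ℂ L V := LieSubmodule.lieSpan ℂ L {Ω}

/-- The sector `h₀ = c` of `V_Ω`. -/
def sector (Ω : V) (c : ℂ) : Submodule ℂ V :=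
  (generatedRep Ω).toSubmodule ⊓ Module.End.eigenspace (LieModule.toEnd ℂ L V (hCartan 0)) c

variable (V) in
/-- The divided power `y^{(n)} = y ^ n / n!`, as an operator on the representation `V`. -/
def divPow (y : L) (n : ℕ) : Module.End ℂ V :=
  ((n.factorial : ℂ)⁻¹) • (LieModule.toEnd ℂ L V y) ^ n

open Polynomial in
/-- `P(u) = ∑_{k=0}^r λ_k (-u)^k`, where `(x₀⁺)^{(k)} (x₁⁻)^{(k)} Ω = λ_k Ω`. For `Ω ≠ 0` there is
at most one such `P`. -/
def IsDrinfeldPolynomial (Ω : V) (r : ℕ) (P : ℂ[X]) : Prop :=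
  ∃ lam : ℕ → ℂ,
    (∀ k ≤ r, divPow V (xPos 0) k (divPow V (xNeg 1) k Ω) = lam k • Ω) ∧
    P = ∑ k ∈ Finset.range (r + 1), C (lam k) * (-X) ^ k

open Polynomial in
/-- `a_1, …, a_s` are the evaluation parameters with multiplicities `m_1, …, m_s` attached to `P`:
they are distinct and nonzero, `m_k ≥ 1`, and `P(u) = ∏_k (1 - a_k u)^{m_k}`. -/
structure IsEvaluationParameters (P : ℂ[X]) {s : ℕ} (a : Fin s → ℂ) (m : Fin s → ℕ) : Prop where
  injective : Function.Injective a
  ne_zero : ∀ k, a k ≠ 0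
  mult_pos : ∀ k, 1 ≤ m k
  factorization : P = ∏ k, (1 - C (a k) * X) ^ m k

/-- The vector `ρ_{j_1}(a) ⋯ ρ_{j_n}(a) Ω`. -/
def rhoVector (Ω : V) {s n : ℕ} (a : Fin s → ℂ) (j : Fin n → Fin s) : V :=
  (List.ofFn fun t => LieModule.toEnd ℂ L V (rho a (j t))).prod Ω

end SlTwoLoop

end

noncomputable section

namespace SlTwoLoop

open scoped TensorProduct LaurentPolynomial
open LieAlgebra
open LaurentPolynomial hiding C

/-! Let `p ⊗ y` act with `p` any Laurent polynomial. If `g = ∏ (t - a_j)`, the claim amounts to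
saying that on `V_Ω` only the values `p(a_j)` matter: morally `L(sl₂)` acts through `s` copies of
`sl₂`, `Ω` has weight 1 for each copy, and `ρ_j` is, up to a nonzero scalar, the lowering operator
of the `j`-th copy, since `∏_{i ≠ j} (t - a_i)` vanishes at every `a_i` except `a_j`. So `V_Ω` looks
like a tensor product of `s` two-dimensional modules, with basis indexed by subsets of the
parameters.

Two facts about `Ω` give this (`IsHighestWeightVector.parameters`). Garland's formula writes
`(x₀⁺)^{(r)} (x₁⁻)^{(r+1)} Ω` as `q ⊗ f` applied to `Ω`, with `q` equal to `t · g` up to sign; the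
left side is zero because `x₁⁻` generates a string of length `r + 1`, so `g ⊗ f` kills `Ω`. The same
recursion yields Newton's identities between the `λ_k` and the eigenvalues of `h_k`, which must
therefore be the power sums of the `a_j`.

Then `ρ_j² Ω = 0` by finite dimension (`rhoList_pair_eq_zero`), independence follows by applying
matching raising operators (`linearIndependent`), and spanning follows from interpolation at the
`a_j` and comparison of weights (`span_eq_sector`). -/

/-- The element `p ⊗ e` of the loop algebra. -/
def pos : ℂ[T;T⁻¹] →ₗ[ℂ] L :=
  (TensorProduct.mk ℂ ℂ[T;T⁻¹] SlTwo).flip (SpecialLinear.single 0 1 zero_ne_one 1)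

/-- The element `p ⊗ f` of the loop algebra. -/
def neg : ℂ[T;T⁻¹] →ₗ[ℂ] L :=
  (TensorProduct.mk ℂ ℂ[T;T⁻¹] SlTwo).flip (SpecialLinear.single 1 0 one_ne_zero 1)

/-- The element `p ⊗ h` of the loop algebra. -/
def cartan : ℂ[T;T⁻¹] →ₗ[ℂ] L :=
  (TensorProduct.mk ℂ ℂ[T;T⁻¹] SlTwo).flip (SpecialLinear.singleSubSingle 0 1 1)

lemma pos_T (k : ℤ) : pos (T k) = xPos k := rfl

lemma neg_T (k : ℤ) : neg (T k) = xNeg k := rfl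

lemma cartan_T (k : ℤ) : cartan (T k) = hCartan k := rfl

lemma lie_pos_neg (p q : ℂ[T;T⁻¹]) : ⁅pos p, neg q⁆ = cartan (p * q) := by
  change ⁅p ⊗ₜ[ℂ] _, q ⊗ₜ[ℂ] _⁆ = (p * q) ⊗ₜ[ℂ] _
  rw [ExtendScalars.bracket_tmul]
  congr 1
  ext i j
  fin_cases i <;> fin_cases j <;> simp [LieRing.of_associative_ring_bracket]

lemma lie_cartan_pos (p q : ℂ[T;T⁻¹]) : ⁅cartan p, pos q⁆ = (2 : ℂ) • pos (p * q) := by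
  change ⁅p ⊗ₜ[ℂ] _, q ⊗ₜ[ℂ] _⁆ = (2 : ℂ) • ((p * q) ⊗ₜ[ℂ] _)
  rw [ExtendScalars.bracket_tmul, ← TensorProduct.tmul_smul]
  congr 1
  ext i j
  fin_cases i <;> fin_cases j <;>
    simp [LieRing.of_associative_ring_bracket, Matrix.mul_apply, Matrix.single_apply]
  norm_num

lemma lie_cartan_neg (p q : ℂ[T;T⁻¹]) : ⁅cartan p, neg q⁆ = (-2 : ℂ) • neg (p * q) := by
  change ⁅p ⊗ₜ[ℂ] _, q ⊗ₜ[ℂ] _⁆ = (-2 : ℂ) • ((p * q) ⊗ₜ[ℂ] _)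
  rw [ExtendScalars.bracket_tmul, ← TensorProduct.tmul_smul]
  congr 1
  ext i j
  fin_cases i <;> fin_cases j <;>
    simp [LieRing.of_associative_ring_bracket, Matrix.mul_apply, Matrix.single_apply]
  norm_num

lemma lie_pos_pos (p q : ℂ[T;T⁻¹]) : ⁅pos p, pos q⁆ = 0 := by
  change ⁅p ⊗ₜ[ℂ] _, q ⊗ₜ[ℂ] _⁆ = _
  rw [ExtendScalars.bracket_tmul, lie_self, TensorProduct.tmul_zero]

lemma lie_neg_neg (p q : ℂ[T;T⁻¹]) : ⁅neg p, neg q⁆ = 0 := by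
  change ⁅p ⊗ₜ[ℂ] _, q ⊗ₜ[ℂ] _⁆ = _
  rw [ExtendScalars.bracket_tmul, lie_self, TensorProduct.tmul_zero]

lemma slTwo_eq (y : SlTwo) :
    y = y.val 0 1 • SpecialLinear.single 0 1 zero_ne_one 1
      + y.val 1 0 • SpecialLinear.single 1 0 one_ne_zero 1
      + y.val 0 0 • SpecialLinear.singleSubSingle 0 1 1 := by
  have hy : Matrix.trace y.val = 0 := y.2
  rw [Matrix.trace_fin_two] at hy
  ext i j
  fin_cases i <;> fin_cases j <;> simp
  linear_combination hy

lemma tmul_eq (p : ℂ[T;T⁻¹]) (y : SlTwo) :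
    (p ⊗ₜ[ℂ] y : L) = y.val 0 1 • pos p + y.val 1 0 • neg p + y.val 0 0 • cartan p := by
  conv_lhs => rw [slTwo_eq y]
  rw [TensorProduct.tmul_add, TensorProduct.tmul_add, TensorProduct.tmul_smul,
    TensorProduct.tmul_smul, TensorProduct.tmul_smul]
  rfl

lemma cartan_T_ne_zero (k : ℤ) : cartan (T k) ≠ 0 := by
  intro h0
  have h1 := congrArg (LoopAlgebra.toFinsupp ℂ ℤ SlTwo) h0
  rw [map_zero] at h1
  have h2 := (LoopAlgebra.toFinsupp_single_tmul ℂ ℤ SlTwo k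
    (SpecialLinear.singleSubSingle 0 1 1)).symm.trans h1
  rw [Finsupp.single_eq_zero] at h2
  have := congrArg (fun y : SlTwo => y.val 0 0) h2
  simp at this

lemma isSl2Triple (k : ℤ) :
    IsSl2Triple (hCartan 0) (xPos (-k)) (xNeg k) where
  h_ne_zero := cartan_T_ne_zero 0
  lie_e_f := by rw [← pos_T, ← neg_T, lie_pos_neg, ← T_add, neg_add_cancel, cartan_T]
  lie_h_e_nsmul := by
    rw [← cartan_T, ← pos_T, lie_cartan_pos, T_zero, one_mul, two_smul, two_nsmul]
  lie_h_f_nsmul := by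
    rw [← cartan_T, ← neg_T, lie_cartan_neg, T_zero, one_mul, two_nsmul]
    module

/-! ### Weights and finite-dimensionality in the representation generated by `Ω` -/

section Module

set_option linter.unusedSectionVars false

variable {V : Type*} [AddCommGroup V] [Module ℂ V] [LieRingModule L V] [LieModule ℂ L V]

lemma loop_smul_lie (c : ℂ) (x : L) (v : V) : ⁅c • x, v⁆ = c • ⁅x, v⁆ := smul_lie c x v

lemma pos_neg_lie (p q : ℂ[T;T⁻¹]) (v : V) :
    ⁅pos p, ⁅neg q, v⁆⁆ = ⁅cartan (p * q), v⁆ + ⁅neg q, ⁅pos p, v⁆⁆ := by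
  rw [leibniz_lie, lie_pos_neg]

lemma cartan_neg_lie (p q : ℂ[T;T⁻¹]) (v : V) :
    ⁅cartan p, ⁅neg q, v⁆⁆ = (-2 : ℂ) • ⁅neg (p * q), v⁆ + ⁅neg q, ⁅cartan p, v⁆⁆ := by
  rw [leibniz_lie, lie_cartan_neg, loop_smul_lie]

lemma cartan_pos_lie (p q : ℂ[T;T⁻¹]) (v : V) :
    ⁅cartan p, ⁅pos q, v⁆⁆ = (2 : ℂ) • ⁅pos (p * q), v⁆ + ⁅pos q, ⁅cartan p, v⁆⁆ := by
  rw [leibniz_lie, lie_cartan_pos, loop_smul_lie]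

lemma neg_neg_lie (p q : ℂ[T;T⁻¹]) (v : V) :
    ⁅neg p, ⁅neg q, v⁆⁆ = ⁅neg q, ⁅neg p, v⁆⁆ := by
  rw [leibniz_lie, lie_neg_neg, zero_lie, zero_add]

lemma pos_pos_lie (p q : ℂ[T;T⁻¹]) (v : V) :
    ⁅pos p, ⁅pos q, v⁆⁆ = ⁅pos q, ⁅pos p, v⁆⁆ := by
  rw [leibniz_lie, lie_pos_pos, zero_lie, zero_add]

lemma mem_generatedRep (Ω : V) : Ω ∈ generatedRep Ω :=
  LieSubmodule.subset_lieSpan rfl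

variable {Ω : V}

lemma IsHighestWeightVector.pos_lie (hΩ : IsHighestWeightVector Ω) (p : ℂ[T;T⁻¹]) :
    ⁅pos p, Ω⁆ = 0 := by
  induction p using LaurentPolynomial.induction_on' with
  | add p q hp hq => rw [map_add, add_lie, hp, hq, add_zero]
  | C_mul_T n a => rw [← smul_eq_C_mul, map_smul, loop_smul_lie, pos_T, hΩ.annihilated, smul_zero]

lemma IsHighestWeightVector.cartan_lie (hΩ : IsHighestWeightVector Ω) (p : ℂ[T;T⁻¹]) :
    ∃ c : ℂ, ⁅cartan p, Ω⁆ = c • Ω := by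
  induction p using LaurentPolynomial.induction_on' with
  | add p q hp hq =>
    obtain ⟨c, hc⟩ := hp
    obtain ⟨d, hd⟩ := hq
    exact ⟨c + d, by rw [map_add, add_lie, hc, hd, add_smul]⟩
  | C_mul_T n a =>
    obtain ⟨c, hc⟩ := hΩ.eigenvector n
    exact ⟨a * c, by rw [← smul_eq_C_mul, map_smul, loop_smul_lie, cartan_T, hc, mul_smul]⟩

/-- `IsLowered Ω n v`: the vector `v` is a product of `n` lowering operators applied to `Ω`. -/
inductive IsLowered (Ω : V) : ℕ → V → Prop
  | base : IsLowered Ω 0 Ω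
  | step (p : ℂ[T;T⁻¹]) {n : ℕ} {v : V} : IsLowered Ω n v → IsLowered Ω (n + 1) ⁅neg p, v⁆

/-- The span of the vectors obtained from `Ω` by lowering operators. -/
def loweredSpan (Ω : V) : Submodule ℂ V := Submodule.span ℂ {v | ∃ n, IsLowered Ω n v}

lemma neg_lie_mem_loweredSpan (p : ℂ[T;T⁻¹]) {v : V} (hv : v ∈ loweredSpan Ω) :
    ⁅neg p, v⁆ ∈ loweredSpan Ω := by
  induction hv using Submodule.span_induction with
  | mem v hv =>
    obtain ⟨n, hn⟩ := hv
    exact Submodule.subset_span ⟨n + 1, hn.step p⟩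
  | zero => simp
  | add v w _ _ hv hw => rw [lie_add]; exact add_mem hv hw
  | smul c v _ hv => rw [lie_smul]; exact Submodule.smul_mem _ c hv

lemma IsHighestWeightVector.cartan_lie_mem (hΩ : IsHighestWeightVector Ω) (p : ℂ[T;T⁻¹]) {v : V}
    (hv : v ∈ loweredSpan Ω) : ⁅cartan p, v⁆ ∈ loweredSpan Ω := by
  induction hv using Submodule.span_induction with
  | mem v hv =>
    obtain ⟨n, hn⟩ := hv
    induction hn with
    | base =>
      obtain ⟨c, hc⟩ := hΩ.cartan_lie p
      rw [hc]
      exact Submodule.smul_mem _ c (Submodule.subset_span ⟨0, .base⟩)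
    | step q hn ih =>
      rw [cartan_neg_lie]
      exact add_mem (Submodule.smul_mem _ _ (Submodule.subset_span ⟨_, hn.step _⟩))
        (neg_lie_mem_loweredSpan q ih)
  | zero => simp
  | add v w _ _ hv hw => rw [lie_add]; exact add_mem hv hw
  | smul c v _ hv => rw [lie_smul]; exact Submodule.smul_mem _ c hv

lemma IsHighestWeightVector.pos_lie_mem (hΩ : IsHighestWeightVector Ω) (p : ℂ[T;T⁻¹]) {v : V}
    (hv : v ∈ loweredSpan Ω) : ⁅pos p, v⁆ ∈ loweredSpan Ω := by
  induction hv using Submodule.span_induction with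
  | mem v hv =>
    obtain ⟨n, hn⟩ := hv
    induction hn with
    | base => rw [hΩ.pos_lie]; exact zero_mem _
    | step q hn ih =>
      rw [pos_neg_lie]
      exact add_mem (hΩ.cartan_lie_mem _ (Submodule.subset_span ⟨_, hn⟩))
        (neg_lie_mem_loweredSpan q ih)
  | zero => simp
  | add v w _ _ hv hw => rw [lie_add]; exact add_mem hv hw
  | smul c v _ hv => rw [lie_smul]; exact Submodule.smul_mem _ c hv

/-- Raising and Cartan operators can be commuted to the right through lowering operators until they
reach `Ω`, so the lowered vectors already span a subrepresentation. -/
lemma IsHighestWeightVector.generatedRep_eq (hΩ : IsHighestWeightVector Ω) :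
    (generatedRep Ω).toSubmodule = loweredSpan Ω := by
  apply le_antisymm
  · let N : LieSubmodule ℂ L V :=
      { loweredSpan Ω with
        lie_mem := by
          intro x v hv
          induction x using TensorProduct.induction_on with
          | zero => rw [zero_lie]; exact zero_mem (loweredSpan Ω)
          | tmul p y =>
            rw [tmul_eq, add_lie, add_lie, loop_smul_lie, loop_smul_lie, loop_smul_lie]
            exact add_mem (add_mem (Submodule.smul_mem _ _ (hΩ.pos_lie_mem p hv))
              (Submodule.smul_mem _ _ (neg_lie_mem_loweredSpan p hv)))
              (Submodule.smul_mem _ _ (hΩ.cartan_lie_mem p hv))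
          | add x y hx hy => rw [add_lie]; exact add_mem (S := Submodule ℂ V) hx hy }
    have : generatedRep Ω ≤ N := by
      refine LieSubmodule.lieSpan_le.2 (Set.singleton_subset_iff.2 ?_)
      exact Submodule.subset_span ⟨0, .base⟩
    exact this
  · refine Submodule.span_le.2 ?_
    rintro v ⟨n, hn⟩
    induction hn with
    | base => exact mem_generatedRep Ω
    | step p _ ih => exact (generatedRep Ω).lie_mem ih

lemma IsHighestWeightVector.generatedRep_le (hΩ : IsHighestWeightVector Ω) {N : Submodule ℂ V}
    (h0 : Ω ∈ N) (hN : ∀ p, ∀ v ∈ N, ⁅neg p, v⁆ ∈ N) : (generatedRep Ω).toSubmodule ≤ N := by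
  rw [hΩ.generatedRep_eq]
  refine Submodule.span_le.2 ?_
  rintro v ⟨n, hn⟩
  induction hn with
  | base => exact h0
  | step p _ ih => exact hN p _ ih

/-- The weight space of `h₀` with eigenvalue `c`. -/
abbrev weightSpace (V : Type*) [AddCommGroup V] [Module ℂ V] [LieRingModule L V]
    [LieModule ℂ L V] (c : ℂ) : Submodule ℂ V :=
  Module.End.eigenspace (LieModule.toEnd ℂ L V (hCartan 0)) c

lemma mem_weightSpace {c : ℂ} {v : V} : v ∈ weightSpace V c ↔ ⁅hCartan 0, v⁆ = c • v := by
  rw [Module.End.mem_eigenspace_iff, LieModule.toEnd_apply_apply]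

lemma neg_lie_mem_weightSpace (p : ℂ[T;T⁻¹]) {c : ℂ} {v : V} (hv : v ∈ weightSpace V c) :
    ⁅neg p, v⁆ ∈ weightSpace V (c - 2) := by
  rw [mem_weightSpace] at *
  rw [← cartan_T] at *
  rw [cartan_neg_lie, hv, T_zero, one_mul, lie_smul, ← add_smul]
  ring_nf

lemma IsLowered.mem_weightSpace {c : ℂ} (hc : ⁅hCartan 0, Ω⁆ = c • Ω) {n : ℕ} {v : V}
    (hv : IsLowered Ω n v) : v ∈ weightSpace V (c - 2 * n) := by
  induction hv with
  | base => rw [SlTwoLoop.mem_weightSpace, hc]; simp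
  | step p _ ih =>
    convert neg_lie_mem_weightSpace p ih using 1
    push_cast
    ring_nf

/-- Lowered vectors have weights `c - 2n`, and eigenspaces of `h₀` are independent, so no other
weight can occur. -/
lemma IsHighestWeightVector.weight_le (hΩ : IsHighestWeightVector Ω) {c d : ℂ}
    (hc : ⁅hCartan 0, Ω⁆ = c • Ω) {v : V} (hv : v ∈ generatedRep Ω) (hd : v ∈ weightSpace V d)
    (hv0 : v ≠ 0) : ∃ n : ℕ, d = c - 2 * n := by
  by_contra! h
  have h1 : v ∈ ⨆ μ, ⨆ (_ : μ ≠ d), weightSpace V μ := by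
    have hle : loweredSpan Ω ≤ ⨆ μ, ⨆ (_ : μ ≠ d), weightSpace V μ := by
      refine Submodule.span_le.2 ?_
      rintro w ⟨n, hn⟩
      exact Submodule.mem_iSup_of_mem _ (Submodule.mem_iSup_of_mem (h n).symm
        (hn.mem_weightSpace hc))
    rw [← hΩ.generatedRep_eq] at hle
    exact hle hv
  have h2 := Module.End.eigenspaces_iSupIndep (LieModule.toEnd ℂ L V (hCartan 0)) d
  exact hv0 ((Submodule.disjoint_def.1 h2) v hd h1)

/-- In a finite-dimensional submodule, a sequence of vectors with pairwise distinct weights has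
a zero term. -/
lemma exists_eq_zero_of_injective_weights {W : Submodule ℂ V} [FiniteDimensional ℂ W]
    {v : ℕ → V} (hv : ∀ n, v n ∈ W) {μ : ℕ → ℂ} (hμ : Function.Injective μ)
    (hw : ∀ n, v n ∈ weightSpace V (μ n)) : ∃ n, v n = 0 := by
  by_contra! h
  have h1 : LinearIndependent ℂ v :=
    Module.End.eigenvectors_linearIndependent' (LieModule.toEnd ℂ L V (hCartan 0)) μ hμ v
      fun n => ⟨hw n, h n⟩
  have h2 : LinearIndependent ℂ fun n => (⟨v n, hv n⟩ : W) :=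
    LinearIndependent.of_comp W.subtype h1
  exact not_finite_iff_infinite.2 (inferInstance : Infinite ℕ) h2.finite

lemma coe_toEnd_pow (W : LieSubmodule ℂ L V) (y : L) (n : ℕ) (w : W) :
    (((LieModule.toEnd ℂ L W y) ^ n) w : V) = ((LieModule.toEnd ℂ L V y) ^ n) (w : V) := by
  induction n with
  | zero => simp
  | succ n ih =>
    rw [pow_succ', pow_succ', Module.End.mul_apply, Module.End.mul_apply,
      LieModule.toEnd_apply_apply, LieSubmodule.coe_bracket, ih, LieModule.toEnd_apply_apply]

lemma primitive_restrict {W : LieSubmodule ℂ L V} {h e f : L} {t : IsSl2Triple h e f} {v : V}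
    (hv : v ∈ W) {μ : ℂ} (hp : t.HasPrimitiveVectorWith v μ) :
    t.HasPrimitiveVectorWith (⟨v, hv⟩ : W) μ where
  ne_zero := fun h => hp.ne_zero (congrArg Subtype.val h)
  lie_h := Subtype.ext hp.lie_h
  lie_e := Subtype.ext hp.lie_e

lemma primitive_exists_nat {W : LieSubmodule ℂ L V} [FiniteDimensional ℂ W]
    {h e f : L} {t : IsSl2Triple h e f} {v : V}
    (hv : v ∈ W) {μ : ℂ} (hp : t.HasPrimitiveVectorWith v μ) :
    ∃ n : ℕ, μ = n := (primitive_restrict hv hp).exists_nat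

lemma primitive_pow_eq_zero {W : LieSubmodule ℂ L V} [FiniteDimensional ℂ W]
    {h e f : L} {t : IsSl2Triple h e f} {v : V}
    (hv : v ∈ W) {n : ℕ} (hp : t.HasPrimitiveVectorWith v (n : ℂ)) :
    ((LieModule.toEnd ℂ L V f) ^ (n + 1)) v = 0 := by
  have := (primitive_restrict hv hp).pow_toEnd_f_eq_zero_of_eq_nat rfl
  rw [← coe_toEnd_pow W f (n + 1) ⟨v, hv⟩, this]
  rfl

lemma IsHighestWeightVector.primitive (hΩ : IsHighestWeightVector Ω) {c : ℂ}
    (hc : ⁅hCartan 0, Ω⁆ = c • Ω) (k : ℤ) :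
    (isSl2Triple k).HasPrimitiveVectorWith Ω c :=
  ⟨hΩ.ne_zero, hc, hΩ.annihilated _⟩

lemma IsHighestWeightVector.exists_weight (hΩ : IsHighestWeightVector Ω)
    [FiniteDimensional ℂ (generatedRep Ω)] : ∃ r : ℕ, ⁅hCartan 0, Ω⁆ = (r : ℂ) • Ω := by
  obtain ⟨c, hc⟩ := hΩ.eigenvector 0
  obtain ⟨r, rfl⟩ := primitive_exists_nat (mem_generatedRep Ω) (hΩ.primitive hc 0)
  exact ⟨r, hc⟩

lemma toEnd_pow_mem (W : LieSubmodule ℂ L V) (y : L) (n : ℕ) {v : V} (hv : v ∈ W) :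
    ((LieModule.toEnd ℂ L V y) ^ n) v ∈ W := by
  rw [← coe_toEnd_pow W y n ⟨v, hv⟩]
  exact Subtype.property _

/-- The extreme vector `(x₁⁻)^r Ω` is mapped to a nonzero vector by `(x₀⁺)^r`. -/
lemma IsHighestWeightVector.pow_pow_ne_zero (hΩ : IsHighestWeightVector Ω)
    [FiniteDimensional ℂ (generatedRep Ω)] {r : ℕ} (hr : ⁅hCartan 0, Ω⁆ = (r : ℂ) • Ω) :
    ((LieModule.toEnd ℂ L V (xPos 0)) ^ r) (((LieModule.toEnd ℂ L V (xNeg 1)) ^ r) Ω) ≠ 0 := by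
  set v := ((LieModule.toEnd ℂ L V (xNeg 1)) ^ r) Ω with hv
  have hP := hΩ.primitive hr 1
  have hv0 : v ≠ 0 := hP.pow_toEnd_f_ne_zero_of_eq_nat rfl le_rfl
  have hvW : v ∈ generatedRep Ω := toEnd_pow_mem _ _ _ (mem_generatedRep Ω)
  have hvw : ⁅hCartan 0, v⁆ = (-r : ℂ) • v := by
    rw [hv, hP.lie_h_pow_toEnd_f]
    congr 1
    ring
  -- In the reversed triple `x₀⁻` plays the raising role. The plan is to show that `v` is already a
  -- lowest weight vector, so that `(x₀⁺)^r` carries it to a nonzero vector.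
  have t : IsSl2Triple (-hCartan 0) (xNeg 0) (xPos 0) := by
    simpa using (isSl2Triple 0).symm
  have hwt (n : ℕ) : ⁅-hCartan 0, ((LieModule.toEnd ℂ L V (xNeg 0)) ^ n) v⁆ =
      ((r : ℂ) + 2 * n) • ((LieModule.toEnd ℂ L V (xNeg 0)) ^ n) v :=
    t.lie_h_pow_toEnd_e (by rw [neg_lie, hvw, neg_smul, neg_neg]) n
  have hex : ∃ n, ((LieModule.toEnd ℂ L V (xNeg 0)) ^ n) v = 0 := by
    have : FiniteDimensional ℂ (generatedRep Ω).toSubmodule := ‹_›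
    refine exists_eq_zero_of_injective_weights (W := (generatedRep Ω).toSubmodule)
      (μ := fun n : ℕ => -((r : ℂ) + 2 * n)) (fun n => toEnd_pow_mem _ _ _ hvW) ?_ ?_
    · intro m n hmn
      simpa using hmn
    · intro n
      rw [mem_weightSpace, neg_smul, ← hwt n, neg_lie, neg_neg]
  -- The last nonzero vector `(x₀⁻)^n v` is primitive for the reversed triple; its string ends in
  -- `h₀`-weight `r + 2n`, which exceeds the top weight `r` unless `n = 0`.
  obtain ⟨n, hn, hn'⟩ := Nat.exists_not_and_succ_of_not_zero_of_exists (by simpa using hv0) hex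
  have hp : t.HasPrimitiveVectorWith (((LieModule.toEnd ℂ L V (xNeg 0)) ^ n) v)
      ((r + 2 * n : ℕ) : ℂ) :=
    ⟨hn, by rw [hwt]; push_cast; rfl, by
      rw [pow_succ', Module.End.mul_apply, LieModule.toEnd_apply_apply] at hn'; exact hn'⟩
  have hne := hp.pow_toEnd_f_ne_zero_of_eq_nat rfl le_rfl
  have hw := hp.lie_h_pow_toEnd_f (r + 2 * n)
  obtain ⟨m, hm⟩ := hΩ.weight_le hr
    (toEnd_pow_mem _ (xPos 0) (r + 2 * n) (toEnd_pow_mem _ (xNeg 0) n hvW))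
    (d := r + 2 * n) (by
      rw [mem_weightSpace, ← neg_inj, ← neg_lie, hw, ← neg_smul]
      congr 1
      push_cast
      ring) hne
  have hnm : ((2 * n + 2 * m : ℕ) : ℂ) = 0 := by
    push_cast
    linear_combination hm
  have hn0 : n = 0 := by
    have := Nat.cast_eq_zero.1 hnm
    omega
  subst hn0
  simpa using hne

end Module

/-! ### Garland's formula and Newton's identities for divided powers -/

section DividedPowers

variable {V : Type*} [AddCommGroup V] [Module ℂ V] [LieRingModule L V] [LieModule ℂ L V]

lemma divPow_zero (y : L) (v : V) : divPow V y 0 v = v := by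
  simp [divPow]

lemma lie_divPow (y : L) (n : ℕ) (v : V) :
    ⁅y, divPow V y n v⁆ = ((n : ℂ) + 1) • divPow V y (n + 1) v := by
  have h : ((n : ℂ) + 1) ≠ 0 := Nat.cast_add_one_ne_zero n
  simp only [divPow, LinearMap.smul_apply, lie_smul, smul_smul, pow_succ', Module.End.mul_apply,
    LieModule.toEnd_apply_apply, Nat.factorial_succ, Nat.cast_mul, Nat.cast_add, Nat.cast_one,
    mul_inv, mul_inv_cancel_left₀ h]

lemma divPow_one (y : L) (v : V) : divPow V y 1 v = ⁅y, v⁆ := by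
  simp [divPow]

lemma pos_divPow (p : ℂ[T;T⁻¹]) (k : ℕ) (v : V) :
    ⁅pos p, divPow V (xPos 0) k v⁆ = divPow V (xPos 0) k ⁅pos p, v⁆ := by
  induction k with
  | zero => simp [divPow_zero]
  | succ k ih =>
    have h : ((k : ℂ) + 1) ≠ 0 := Nat.cast_add_one_ne_zero k
    apply smul_right_injective V h
    simp only
    rw [← lie_smul, ← lie_divPow, ← lie_divPow, ← pos_T, pos_pos_lie, pos_T, ih]

lemma cartan_divPow (p : ℂ[T;T⁻¹]) (k : ℕ) (v : V) :
    ⁅cartan p, divPow V (xPos 0) (k + 1) v⁆ =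
      divPow V (xPos 0) (k + 1) ⁅cartan p, v⁆ + (2 : ℂ) • ⁅pos p, divPow V (xPos 0) k v⁆ := by
  induction k with
  | zero =>
    rw [divPow_one, divPow_one, divPow_zero, ← pos_T, cartan_pos_lie, T_zero, mul_one, add_comm]
  | succ k ih =>
    have h : (((k + 1 : ℕ) : ℂ) + 1) ≠ 0 := Nat.cast_add_one_ne_zero _
    apply smul_right_injective V h
    simp only
    rw [← lie_smul, ← lie_divPow, smul_add, ← lie_divPow, ← pos_T, cartan_pos_lie, T_zero, mul_one,
      ← T_zero, pos_T, ih, lie_add, lie_smul, ← pos_T, pos_pos_lie _ p, pos_T, lie_divPow, lie_divPow,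
      lie_smul]
    push_cast
    module

variable {Ω : V} {d : ℤ → ℂ}

lemma cartan_lie_divPow (hd : ∀ k, ⁅hCartan k, Ω⁆ = d k • Ω) (j : ℤ) (m : ℕ) :
    ⁅cartan (T j), divPow V (xNeg 1) (m + 1) Ω⁆ =
      d j • divPow V (xNeg 1) (m + 1) Ω - (2 : ℂ) • ⁅neg (T (j + 1)), divPow V (xNeg 1) m Ω⁆ := by
  induction m with
  | zero =>
    rw [divPow_one, divPow_zero, ← neg_T, cartan_neg_lie, cartan_T, hd, lie_smul, ← T_add]
    module
  | succ m ih =>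
    have h : (((m + 1 : ℕ) : ℂ) + 1) ≠ 0 := Nat.cast_add_one_ne_zero _
    apply smul_right_injective V h
    simp only
    rw [← lie_smul, ← lie_divPow, ← neg_T, cartan_neg_lie, ← T_add, neg_T 1, ih, lie_sub, lie_smul,
      lie_smul, ← neg_T, neg_neg_lie (T 1), neg_T 1, lie_divPow, lie_divPow, lie_smul]
    push_cast
    module

/-- Moving `p ⊗ e` through the power of `x₁⁻` leaves a Cartan term at each position; averaging the
eigenvalue on `Ω` with the Cartan action on the whole power sums them, and the factor 2 clears that
average. -/
lemma pos_lie_divPow (hΩ : IsHighestWeightVector Ω) (hd : ∀ k, ⁅hCartan k, Ω⁆ = d k • Ω)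
    (i : ℤ) (m : ℕ) :
    (2 : ℂ) • ⁅pos (T i), divPow V (xNeg 1) (m + 1) Ω⁆ =
      d (i + 1) • divPow V (xNeg 1) m Ω + ⁅cartan (T (i + 1)), divPow V (xNeg 1) m Ω⁆ := by
  induction m with
  | zero =>
    rw [divPow_one, divPow_zero, ← neg_T, pos_neg_lie, hΩ.pos_lie, lie_zero, add_zero, ← T_add,
      cartan_T, hd]
    module
  | succ m ih =>
    have h : (((m + 1 : ℕ) : ℂ) + 1) ≠ 0 := Nat.cast_add_one_ne_zero _
    apply smul_right_injective V h
    simp only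
    have h1 : ⁅xNeg 1, ⁅cartan (T (i + 1)), divPow V (xNeg 1) m Ω⁆⁆ =
        ((m : ℂ) + 1) • ⁅cartan (T (i + 1)), divPow V (xNeg 1) (m + 1) Ω⁆ +
          (2 : ℂ) • ⁅neg (T (i + 1 + 1)), divPow V (xNeg 1) m Ω⁆ := by
      have := cartan_neg_lie (T (i + 1)) (T 1) (divPow V (xNeg 1) m Ω)
      rw [neg_T 1, lie_divPow, lie_smul, ← T_add, neg_smul] at this
      rw [this]
      abel
    have h2 := cartan_lie_divPow hd (i + 1) m
    have h3 : (2 : ℂ) • ⁅neg (T (i + 1 + 1)), divPow V (xNeg 1) m Ω⁆ =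
        d (i + 1) • divPow V (xNeg 1) (m + 1) Ω -
          ⁅cartan (T (i + 1)), divPow V (xNeg 1) (m + 1) Ω⁆ := by
      rw [h2]; abel
    rw [smul_comm, ← lie_smul, ← lie_divPow, ← neg_T, pos_neg_lie, smul_add, ← lie_smul _ (neg _),
      neg_T, ih, lie_add, h1, h3, ← T_add, lie_smul, lie_divPow]
    push_cast
    module

/-- The recursion behind Garland's formula. -/
lemma pos_lie_divPow_divPow (hΩ : IsHighestWeightVector Ω)
    (hd : ∀ k, ⁅hCartan k, Ω⁆ = d k • Ω) (c k : ℕ) (i : ℤ) :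
    (2 : ℂ) • ⁅pos (T i), divPow V (xPos 0) k (divPow V (xNeg 1) (k + c + 1) Ω)⁆ =
      ∑ j ∈ Finset.range (k + 1), (-1 : ℂ) ^ j •
        (d (i + 1 + j) • divPow V (xPos 0) (k - j) (divPow V (xNeg 1) (k - j + c) Ω) +
          ⁅cartan (T (i + 1 + j)),
            divPow V (xPos 0) (k - j) (divPow V (xNeg 1) (k - j + c) Ω)⁆) := by
  induction k generalizing i with
  | zero => simp [divPow_zero, pos_lie_divPow hΩ hd]
  | succ k ih =>
    -- Commuting the Cartan term back out of the power of `x₀⁺` produces the same expression with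
    -- `k` lowered and `i` raised by one, hence the alternating sum.
    rw [Finset.sum_range_succ', pos_divPow, ← map_smul, pos_lie_divPow hΩ hd, map_add, map_smul]
    have h1 := cartan_divPow (T (i + 1)) k (divPow V (xNeg 1) (k + 1 + c) Ω)
    have h2 := ih (i + 1)
    have h3 : k + c + 1 = k + 1 + c := by ring
    rw [h3] at h2
    rw [h2] at h1
    have h4 : ∀ j ∈ Finset.range (k + 1), (-1 : ℂ) ^ (j + 1) •
        (d (i + 1 + (j + 1 : ℕ)) • divPow V (xPos 0) (k + 1 - (j + 1))
            (divPow V (xNeg 1) (k + 1 - (j + 1) + c) Ω) +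
          ⁅cartan (T (i + 1 + (j + 1 : ℕ))), divPow V (xPos 0) (k + 1 - (j + 1))
            (divPow V (xNeg 1) (k + 1 - (j + 1) + c) Ω)⁆) = -((-1 : ℂ) ^ j •
        (d (i + 1 + 1 + j) • divPow V (xPos 0) (k - j) (divPow V (xNeg 1) (k - j + c) Ω) +
          ⁅cartan (T (i + 1 + 1 + j)),
            divPow V (xPos 0) (k - j) (divPow V (xNeg 1) (k - j + c) Ω)⁆)) := by
      intro j _
      have h5 : i + 1 + ((j + 1 : ℕ) : ℤ) = i + 1 + 1 + j := by push_cast; ring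
      rw [h5, Nat.add_sub_add_right, pow_succ, mul_neg_one, neg_smul]
    rw [Finset.sum_congr rfl h4, Finset.sum_neg_distrib]
    simp only [pow_zero, one_smul, Nat.cast_zero, add_zero, Nat.sub_zero]
    rw [h1]
    abel

/-- At `i = 0` the extra raising operator is `x₀⁺` itself and joins the divided power. The case `c =
0` gives Newton's identities, `c = 1` Garland's formula. -/
lemma divPow_divPow_succ (hΩ : IsHighestWeightVector Ω)
    (hd : ∀ k, ⁅hCartan k, Ω⁆ = d k • Ω) (c k : ℕ) :
    (2 * ((k : ℂ) + 1)) • divPow V (xPos 0) (k + 1) (divPow V (xNeg 1) (k + c + 1) Ω) =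
      ∑ j ∈ Finset.range (k + 1), (-1 : ℂ) ^ j •
        (d (1 + j) • divPow V (xPos 0) (k - j) (divPow V (xNeg 1) (k - j + c) Ω) +
          ⁅cartan (T (1 + j)),
            divPow V (xPos 0) (k - j) (divPow V (xNeg 1) (k - j + c) Ω)⁆) := by
  have := pos_lie_divPow_divPow hΩ hd c k 0
  rw [pos_T, lie_divPow, smul_smul] at this
  simpa using this

lemma exists_divPow_divPow_eq_smul (hΩ : IsHighestWeightVector Ω) :
    ∃ lam : ℕ → ℂ, ∀ k, divPow V (xPos 0) k (divPow V (xNeg 1) k Ω) = lam k • Ω := by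
  choose d hd using hΩ.eigenvector
  suffices ∀ k, ∃ l : ℂ, divPow V (xPos 0) k (divPow V (xNeg 1) k Ω) = l • Ω by
    choose lam hlam using this
    exact ⟨lam, hlam⟩
  intro k
  induction k using Nat.strong_induction_on with
  | _ k ih =>
    obtain _ | k := k
    · exact ⟨1, by simp [divPow_zero]⟩
    have hne : (2 * ((k : ℂ) + 1)) ≠ 0 := mul_ne_zero two_ne_zero (Nat.cast_add_one_ne_zero k)
    have h := divPow_divPow_succ hΩ hd 0 k
    have hmem : (2 * ((k : ℂ) + 1)) • divPow V (xPos 0) (k + 1) (divPow V (xNeg 1) (k + 1) Ω) ∈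
        Submodule.span ℂ {Ω} := by
      rw [add_zero] at h
      rw [h]
      refine Submodule.sum_mem _ fun j _ => Submodule.smul_mem _ _ ?_
      obtain ⟨l, hl⟩ := ih (k - j) (by omega)
      rw [add_zero, hl, cartan_T, lie_smul, hd]
      have := Submodule.mem_span_singleton_self (R := ℂ) Ω
      exact add_mem (Submodule.smul_mem _ _ (Submodule.smul_mem _ _ this))
        (Submodule.smul_mem _ _ (Submodule.smul_mem _ _ this))
    obtain ⟨l, hl⟩ := Submodule.mem_span_singleton.1 ((Submodule.smul_mem_iff _ hne).1 hmem)
    exact ⟨l, hl.symm⟩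

variable {lam : ℕ → ℂ}

/-- For `c = 0` every vector is a multiple of `Ω`, so the two summands of the recursion coincide and
the factor 2 cancels. -/
lemma newton_recursion (hΩ : IsHighestWeightVector Ω) (hd : ∀ k, ⁅hCartan k, Ω⁆ = d k • Ω)
    (hlam : ∀ k, divPow V (xPos 0) k (divPow V (xNeg 1) k Ω) = lam k • Ω) (k : ℕ) :
    ((k : ℂ) + 1) * lam (k + 1) =
      ∑ j ∈ Finset.range (k + 1), (-1 : ℂ) ^ j * (d (1 + j) * lam (k - j)) := by
  have h := divPow_divPow_succ hΩ hd 0 k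
  simp only [add_zero, hlam, cartan_T, lie_smul, hd, smul_smul] at h
  have h1 : ∀ j ∈ Finset.range (k + 1), (-1 : ℂ) ^ j •
      ((d (1 + j) * lam (k - j)) • Ω + (lam (k - j) * d (1 + j)) • Ω) =
      (2 * ((-1 : ℂ) ^ j * (d (1 + j) * lam (k - j)))) • Ω := by
    intro j _
    module
  rw [Finset.sum_congr rfl h1, ← Finset.sum_smul, ← Finset.mul_sum] at h
  have h2 := smul_left_injective ℂ hΩ.ne_zero h
  rw [mul_assoc] at h2
  exact mul_left_cancel₀ two_ne_zero h2

/-- The Laurent polynomials `∑_{i ≤ n} (-1)^{n-i} λ_i t^{n+1-i}`. -/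
def garland (lam : ℕ → ℂ) : ℕ → ℂ[T;T⁻¹]
  | 0 => lam 0 • T 1
  | n + 1 => lam (n + 1) • T 1 - T 1 * garland lam n

lemma garland_eq (lam : ℕ → ℂ) (n : ℕ) :
    garland lam n = (-1 : ℂ) ^ n • (T (n + 1) *
      ∑ i ∈ Finset.range (n + 1), ((-1 : ℂ) ^ i * lam i) • T (-i : ℤ)) := by
  induction n with
  | zero => simp [garland]
  | succ n ih =>
    rw [garland, ih, Finset.sum_range_succ _ (n + 1), mul_add, smul_add, mul_smul_comm,
      mul_smul_comm, ← T_add, smul_smul, ← mul_assoc ((-1 : ℂ) ^ (n + 1)), ← mul_pow,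
      ← mul_assoc (T 1), ← T_add, pow_succ, mul_neg_one, neg_smul]
    have h1 : ((n + 1 : ℕ) : ℤ) + 1 + -((n + 1 : ℕ) : ℤ) = 1 := by ring
    have h2 : (1 : ℤ) + (n + 1) = ((n + 1 : ℕ) : ℤ) + 1 := by push_cast; ring
    rw [h1, h2]
    simp only [mul_neg, mul_one, neg_neg, one_pow, one_mul]
    abel

/-- This is the recursion for `c = 1` transported to Laurent polynomials: the Cartan action on `q ⊗
f` contributes the products with `T (1 + j)`. -/
lemma garland_recursion (h0 : lam 0 = 1)
    (hN : ∀ k : ℕ, ((k : ℂ) + 1) * lam (k + 1) =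
      ∑ j ∈ Finset.range (k + 1), (-1 : ℂ) ^ j * (d (1 + j) * lam (k - j))) (n : ℕ) :
    ((n : ℂ) + 1) • garland lam (n + 1) =
      ∑ j ∈ Finset.range (n + 1), (-1 : ℂ) ^ j • (d (1 + j) • garland lam (n - j)) -
      ∑ j ∈ Finset.range (n + 1), (-1 : ℂ) ^ j • (T (1 + j) * garland lam (n - j)) := by
  induction n with
  | zero =>
    have h1 : lam 1 = d 1 := by simpa [h0] using hN 0
    have h2 : garland lam 1 = lam 1 • T 1 - T 1 * (lam 0 • T 1) := rfl
    have h3 : garland lam 0 = lam 0 • T 1 := rfl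
    simp only [zero_add, Finset.range_one, Finset.sum_singleton, Nat.cast_zero, pow_zero, one_smul,
      add_zero, Nat.sub_zero, h1, h2, h3, h0]
  | succ n ih =>
    have hA : ∑ j ∈ Finset.range (n + 1 + 1),
          (-1 : ℂ) ^ j • (d (1 + j) • garland lam (n + 1 - j)) =
        (((n + 1 : ℕ) : ℂ) + 1) • lam (n + 1 + 1) • T 1 - T 1 *
          ∑ j ∈ Finset.range (n + 1), (-1 : ℂ) ^ j • (d (1 + j) • garland lam (n - j)) := by
      rw [smul_smul, hN, Finset.sum_smul, Finset.sum_range_succ, Finset.sum_range_succ _ (n + 1),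
        Finset.mul_sum, add_sub_right_comm, ← Finset.sum_sub_distrib]
      congr 1
      · refine Finset.sum_congr rfl fun j hj => ?_
        have hj' : n + 1 - j = n - j + 1 := by
          have := Finset.mem_range.1 hj
          omega
        rw [hj', garland, mul_smul_comm, mul_smul_comm]
        module
      · rw [Nat.sub_self, garland]
        module
    have hB : ∑ j ∈ Finset.range (n + 1 + 1),
          (-1 : ℂ) ^ j • (T (1 + j) * garland lam (n + 1 - j)) =
        T 1 * garland lam (n + 1) - T 1 *
          ∑ j ∈ Finset.range (n + 1), (-1 : ℂ) ^ j • (T (1 + j) * garland lam (n - j)) := by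
      rw [Finset.sum_range_succ', Finset.mul_sum, sub_eq_neg_add, ← Finset.sum_neg_distrib]
      congr 1
      · refine Finset.sum_congr rfl fun j _ => ?_
        rw [Nat.add_sub_add_right, pow_succ, mul_neg_one, neg_smul, mul_smul_comm, ← mul_assoc,
          ← T_add]
        push_cast
        rw [add_comm (j : ℤ) 1]
      · simp
    rw [hA, hB, garland]
    have h1 := congrArg (fun x => T 1 * x) ih
    simp only [mul_sub, mul_smul_comm] at h1
    rw [smul_sub]
    push_cast
    rw [add_smul ((n : ℂ) + 1) 1 (T 1 * _), h1]
    module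

/-- Garland's formula for `(x₀⁺)^{(n)} (x₁⁻)^{(n+1)} Ω`. -/
lemma divPow_divPow_succ_eq (hΩ : IsHighestWeightVector Ω)
    (hd : ∀ k, ⁅hCartan k, Ω⁆ = d k • Ω)
    (hlam : ∀ k, divPow V (xPos 0) k (divPow V (xNeg 1) k Ω) = lam k • Ω) (n : ℕ) :
    divPow V (xPos 0) n (divPow V (xNeg 1) (n + 1) Ω) = ⁅neg (garland lam n), Ω⁆ := by
  have h0 : lam 0 = 1 := by
    have := hlam 0
    rw [divPow_zero, divPow_zero] at this
    exact smul_left_injective ℂ hΩ.ne_zero (by simpa using this.symm)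
  induction n using Nat.strong_induction_on with
  | _ n ih =>
    obtain _ | n := n
    · rw [divPow_zero, divPow_one, garland, h0, one_smul, neg_T]
    have hne : (2 * ((n : ℂ) + 1)) ≠ 0 := mul_ne_zero two_ne_zero (Nat.cast_add_one_ne_zero n)
    apply smul_right_injective V hne
    simp only
    rw [divPow_divPow_succ hΩ hd 1 n]
    have h1 : ∀ j ∈ Finset.range (n + 1), (-1 : ℂ) ^ j •
        (d (1 + j) • divPow V (xPos 0) (n - j) (divPow V (xNeg 1) (n - j + 1) Ω) +
          ⁅cartan (T (1 + j)), divPow V (xPos 0) (n - j) (divPow V (xNeg 1) (n - j + 1) Ω)⁆) =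
        (2 : ℂ) • ⁅neg ((-1 : ℂ) ^ j • (d (1 + j) • garland lam (n - j)) -
          (-1 : ℂ) ^ j • (T (1 + j) * garland lam (n - j))), Ω⁆ := by
      intro j _
      rw [ih (n - j) (by omega), cartan_neg_lie, cartan_T, hd, map_sub, sub_lie, map_smul, map_smul,
        map_smul, loop_smul_lie, loop_smul_lie, loop_smul_lie, lie_smul]
      module
    rw [Finset.sum_congr rfl h1, ← Finset.smul_sum, mul_smul]
    congr 1
    rw [← loop_smul_lie, ← map_smul, garland_recursion h0 (newton_recursion hΩ hd hlam),
      ← Finset.sum_sub_distrib, map_sum, sum_lie]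

end DividedPowers

/-! ### Coefficients and degree of the Drinfeld polynomial -/

section DrinfeldPolynomial

open Polynomial

lemma coeff_sum_C_mul_neg_X_pow (lam : ℕ → ℂ) (r n : ℕ) :
    (∑ k ∈ Finset.range (r + 1), C (lam k) * (-X) ^ k : ℂ[X]).coeff n =
      if n ≤ r then (-1) ^ n * lam n else 0 := by
  have h : ∀ k ∈ Finset.range (r + 1), (C (lam k) * (-X) ^ k : ℂ[X]).coeff n =
      if n = k then (-1) ^ k * lam k else 0 := by
    intro k _
    have : (C (lam k) * (-X) ^ k : ℂ[X]) = C ((-1) ^ k * lam k) * X ^ k := by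
      rw [neg_pow, C_mul, C_pow, C_neg, C_1]
      ring
    rw [this, coeff_C_mul_X_pow]
  rw [finsetSum_coeff, Finset.sum_congr rfl h, Finset.sum_ite_eq]
  simp

lemma natDegree_prod_one_sub {s : ℕ} {a : Fin s → ℂ} (ha : ∀ k, a k ≠ 0) :
    (∏ k, (1 - C (a k) * X) : ℂ[X]).natDegree = s := by
  have h (k : Fin s) : (1 - C (a k) * X : ℂ[X]).natDegree = 1 := by
    have : (1 - C (a k) * X : ℂ[X]) = C (-a k) * X + C 1 := by
      rw [C_neg, C_1]
      ring
    rw [this]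
    exact natDegree_linear (neg_ne_zero.2 (ha k))
  rw [natDegree_prod]
  · simp [h]
  · intro k _ h0
    have := h k
    simp [h0] at this

end DrinfeldPolynomial

/-! ### Power sums from the logarithmic derivative -/

section PowerSums

open PowerSeries

lemma derivative_prod_one_sub {ι : Type*} (S : Finset ι) (a : ι → ℂ) :
    d⁄dX ℂ (∏ k ∈ S, (1 - C (a k) * X : ℂ⟦X⟧)) =
      -((∏ k ∈ S, (1 - C (a k) * X)) * PowerSeries.mk fun j => ∑ k ∈ S, a k ^ (j + 1)) := by
  classical
  induction S using Finset.induction_on with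
  | empty =>
    have : (PowerSeries.mk fun j => ∑ k ∈ (∅ : Finset ι), a k ^ (j + 1)) = 0 := by
      ext; simp
    rw [this]
    simp
  | insert i S hi ih =>
    have h1 : (PowerSeries.mk fun j => ∑ k ∈ insert i S, a k ^ (j + 1)) =
        (PowerSeries.mk fun j => a i ^ (j + 1)) + PowerSeries.mk fun j => ∑ k ∈ S, a k ^ (j + 1) := by
      ext j
      simp [Finset.sum_insert hi]
    have h2 : (1 - C (a i) * X : ℂ⟦X⟧) * (PowerSeries.mk fun j => a i ^ (j + 1)) = C (a i) := by
      ext j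
      rw [sub_mul, one_mul, mul_assoc]
      obtain _ | j := j
      · simp
      · simp [pow_succ', coeff_succ_X_mul]
    have h3 : d⁄dX ℂ (1 - C (a i) * X : ℂ⟦X⟧) = - C (a i) := by
      rw [map_sub, Derivation.leibniz, derivative_X, derivative_C]
      simp
    rw [Finset.prod_insert hi, Derivation.leibniz, ih, h3, h1]
    simp only [smul_eq_mul]
    linear_combination (∏ k ∈ S, (1 - C (a k) * X : ℂ⟦X⟧)) * h2

/-- Newton's identities determine the power sums from the coefficients of `∏ (1 - a_k u)`. -/
lemma eq_power_sum {s : ℕ} {a : Fin s → ℂ} {lam : ℕ → ℂ} {d : ℤ → ℂ}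
    (hN : ∀ k : ℕ, ((k : ℂ) + 1) * lam (k + 1) =
      ∑ j ∈ Finset.range (k + 1), (-1 : ℂ) ^ j * (d (1 + j) * lam (k - j)))
    (hP : (PowerSeries.mk fun n => (-1) ^ n * lam n) = ∏ k, (1 - C (a k) * X : ℂ⟦X⟧)) (j : ℕ) :
    d (1 + j) = ∑ k, a k ^ (j + 1) := by
  -- Newton's recursion says that `-∑ d_{j+1} u^j` is the logarithmic derivative of the series; for
  -- the product it is minus the generating series of the power sums, and the nonzero series
  -- cancels.
  have h1 : d⁄dX ℂ (PowerSeries.mk fun n => (-1) ^ n * lam n) =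
      -((PowerSeries.mk fun n => (-1) ^ n * lam n) * PowerSeries.mk fun j : ℕ => d (1 + j)) := by
    ext n
    rw [coeff_derivative, coeff_mk, map_neg, mul_comm (PowerSeries.mk _), coeff_mul,
      Finset.Nat.sum_antidiagonal_eq_sum_range_succ_mk]
    simp only [coeff_mk]
    have h := hN n
    have h' : (-1) ^ (n + 1) * lam (n + 1) * ((n : ℂ) + 1) =
        (-1) ^ (n + 1) * (((n : ℂ) + 1) * lam (n + 1)) := by ring
    rw [h', h, Finset.mul_sum, ← Finset.sum_neg_distrib]
    refine Finset.sum_congr rfl fun j hj => ?_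
    have hj' : n = n - j + j := by
      have := Finset.mem_range.1 hj
      omega
    have h2 : (-1 : ℂ) ^ (n + 1) * (-1) ^ j = -(-1) ^ (n - j) := by
      conv_lhs => rw [hj']
      rw [pow_succ, pow_add]
      have : (-1 : ℂ) ^ j * (-1) ^ j = 1 := by rw [← mul_pow]; simp
      linear_combination -(-1 : ℂ) ^ (n - j) * this
    linear_combination (d (1 + j) * lam (n - j)) * h2
  have h2 := derivative_prod_one_sub Finset.univ a
  rw [← hP, h1, neg_inj] at h2
  have hne : (PowerSeries.mk fun n => (-1) ^ n * lam n) ≠ 0 := by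
    rw [hP, Finset.prod_ne_zero_iff]
    intro k _ h
    have := congrArg (coeff 0) h
    simp at this
  have h3 := congrArg (coeff j) (mul_left_cancel₀ hne h2)
  simpa using h3

end PowerSums

/-! ### Evaluation at the parameters and the ideal generated by `∏ (t - a_j)` -/

/-- Evaluation of Laurent polynomials at a nonzero complex number. -/
def ev (b : ℂˣ) : ℂ[T;T⁻¹] →ₐ[ℂ] ℂ :=
  { eval₂ (RingHom.id ℂ) b with
    commutes' := fun c => by
      rw [← C_eq_algebraMap]
      exact eval₂_C (RingHom.id ℂ) b c }

lemma ev_toLaurent (b : ℂˣ) (f : Polynomial ℂ) : ev b (Polynomial.toLaurent f) = f.eval (b : ℂ) :=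
  eval₂_toLaurent (RingHom.id ℂ) b f

lemma ev_T_natCast (b : ℂˣ) (n : ℕ) : ev b (T n) = (b : ℂ) ^ n := by
  rw [← Polynomial.toLaurent_X_pow, ev_toLaurent]
  simp

section Nodal

open Polynomial

variable {s : ℕ}

/-- The polynomial `∏_j (t - a_j)`. -/
def nodal (u : Fin s → ℂˣ) : ℂ[X] := ∏ j, (X - C (u j : ℂ))

lemma eval_nodal (u : Fin s → ℂˣ) (j : Fin s) : (nodal u).eval (u j : ℂ) = 0 := by
  rw [nodal, eval_prod]
  exact Finset.prod_eq_zero (Finset.mem_univ j) (by simp)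

lemma toLaurent_nodal_dvd {u : Fin s → ℂˣ} (hu : Function.Injective u) {p : ℂ[T;T⁻¹]}
    (hp : ∀ j, ev (u j) p = 0) : toLaurent (nodal u) ∣ p := by
  obtain ⟨n, f, hf⟩ := exists_T_pow p
  have hdvd : nodal u ∣ f := by
    refine Finset.prod_dvd_of_coprime ?_ ?_
    · intro i _ j _ hij
      exact pairwise_coprime_X_sub_C (Units.val_injective.comp hu) hij
    · intro j _
      rw [dvd_iff_isRoot, IsRoot, ← ev_toLaurent, hf, map_mul, hp, zero_mul]
  have h1 : p = toLaurent f * LaurentPolynomial.T (-n) := by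
    rw [hf, mul_T_assoc, add_neg_cancel, T_zero, mul_one]
  rw [h1]
  exact Dvd.dvd.mul_right (map_dvd toLaurent hdvd) _

/-- Powers of `t` are invertible modulo `nodal u`, so negative modes can be traded for polynomial
ones. -/
lemma isCoprime_nodal_X_pow (u : Fin s → ℂˣ) (n : ℕ) : IsCoprime (nodal u) (X ^ n) := by
  refine IsCoprime.pow_right (IsCoprime.prod_left fun j _ => ?_)
  have h := isCoprime_X_sub_C_of_isUnit_sub (R := ℂ) (a := (u j : ℂ)) (b := 0)
    (by simp)
  simpa using h

lemma toLaurent_nodal (u : Fin s → ℂˣ) :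
    toLaurent (nodal u) =
      LaurentPolynomial.T s * invert (toLaurent (∏ j, (1 - C (u j : ℂ) * X))) := by
  rw [nodal, map_prod, map_prod, map_prod]
  have h1 : (LaurentPolynomial.T s : ℂ[T;T⁻¹]) = ∏ _j : Fin s, LaurentPolynomial.T 1 := by
    rw [Finset.prod_const, T_pow]
    simp
  rw [h1, ← Finset.prod_mul_distrib]
  refine Finset.prod_congr rfl fun j _ => ?_
  simp only [map_sub, map_mul, map_one, toLaurent_X, toLaurent_C, invert_T, invert_C, mul_sub,
    mul_one]
  rw [mul_left_comm, ← T_add, add_neg_cancel, T_zero, mul_one]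

lemma garland_eq_invert (lam : ℕ → ℂ) (r : ℕ) :
    garland lam r = (-1 : ℂ) ^ r • (LaurentPolynomial.T (r + 1) *
      invert (toLaurent (∑ k ∈ Finset.range (r + 1), C (lam k) * (-X) ^ k))) := by
  rw [garland_eq, map_sum, map_sum]
  congr 2
  refine Finset.sum_congr rfl fun k _ => ?_
  rw [map_mul, map_mul, map_pow, map_pow, map_neg, map_neg, toLaurent_C, toLaurent_X, invert_C,
    invert_T, neg_pow (LaurentPolynomial.T (-1) : ℂ[T;T⁻¹]), T_pow, LaurentPolynomial.smul_eq_C_mul, map_mul, map_pow, map_neg, map_one]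
  simp only [mul_neg, mul_one]
  ring

end Nodal

/-! ### Action of the loop algebra on `Ω` in terms of the parameters -/

section Parameters

variable {V : Type*} [AddCommGroup V] [Module ℂ V] [LieRingModule L V] [LieModule ℂ L V]
variable {Ω : V} {s : ℕ} {u : Fin s → ℂˣ}

/-- The `p` with `p ⊗ f` killing `Ω` form an ideal: applying `q ⊗ h` to the relation multiplies `p`
by `q`, because `Ω` is a Cartan eigenvector. -/
lemma IsHighestWeightVector.neg_mul_lie (hΩ : IsHighestWeightVector Ω) {p : ℂ[T;T⁻¹]}
    (hp : ⁅neg p, Ω⁆ = 0) (q : ℂ[T;T⁻¹]) : ⁅neg (q * p), Ω⁆ = 0 := by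
  have h := cartan_neg_lie q p Ω
  obtain ⟨c, hc⟩ := hΩ.cartan_lie q
  rw [hp, lie_zero, hc, lie_smul, hp, smul_zero, add_zero] at h
  exact (smul_eq_zero.1 h.symm).resolve_left (by norm_num)

lemma IsHighestWeightVector.cartan_mul_lie (hΩ : IsHighestWeightVector Ω) {p : ℂ[T;T⁻¹]}
    (hp : ⁅neg p, Ω⁆ = 0) (q : ℂ[T;T⁻¹]) : ⁅cartan (q * p), Ω⁆ = 0 := by
  have h := pos_neg_lie q p Ω
  rw [hp, lie_zero, hΩ.pos_lie, lie_zero, add_zero] at h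
  exact h.symm

lemma IsHighestWeightVector.cartan_lie_eq (hΩ : IsHighestWeightVector Ω)
    (hg : ⁅neg (Polynomial.toLaurent (nodal u)), Ω⁆ = 0)
    (hd : ∀ n : ℕ, ⁅hCartan n, Ω⁆ = (∑ j, (u j : ℂ) ^ n) • Ω) (p : ℂ[T;T⁻¹]) :
    ⁅cartan p, Ω⁆ = (∑ j, ev (u j) p) • Ω := by
  have hpoly (f : Polynomial ℂ) : ⁅cartan (Polynomial.toLaurent f), Ω⁆ =
      (∑ j, ev (u j) (Polynomial.toLaurent f)) • Ω := by
    induction f using Polynomial.induction_on' with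
    | add f g hf hg =>
      simp only [map_add, add_lie, hf, hg, Finset.sum_add_distrib, add_smul]
    | monomial n c =>
      rw [← Polynomial.C_mul_X_pow_eq_monomial, Polynomial.toLaurent_C_mul_X_pow,
        ← smul_eq_C_mul, map_smul, loop_smul_lie, cartan_T, hd, smul_smul]
      simp only [map_smul, ev_T_natCast, smul_eq_mul, Finset.mul_sum]
  obtain ⟨n, f, hf⟩ := exists_T_pow p
  obtain ⟨a, b, hab⟩ := isCoprime_nodal_X_pow u n
  have h1 := congrArg Polynomial.toLaurent hab
  rw [map_add, map_mul, map_mul, Polynomial.toLaurent_X_pow, map_one] at h1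
  -- Modulo `nodal u`, `p` agrees with the genuine polynomial `b * f`, and `hd` covers nonnegative
  -- modes only.
  have h2 : p = (p * Polynomial.toLaurent a) * Polynomial.toLaurent (nodal u) +
      Polynomial.toLaurent (b * f) := by
    rw [map_mul, hf]
    linear_combination -p * h1
  rw [h2, map_add, add_lie, hΩ.cartan_mul_lie hg, zero_add, hpoly]
  congr 1
  refine Finset.sum_congr rfl fun j _ => ?_
  rw [map_add, map_mul _ (p * _), ev_toLaurent _ (nodal u), eval_nodal, mul_zero, zero_add]

variable {r : ℕ}

lemma IsHighestWeightVector.divPow_xNeg_eq_zero (hΩ : IsHighestWeightVector Ω)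
    [FiniteDimensional ℂ (generatedRep Ω)] (hr : ⁅hCartan 0, Ω⁆ = (r : ℂ) • Ω) {k : ℕ}
    (hk : r < k) : divPow V (xNeg 1) k Ω = 0 := by
  have h := primitive_pow_eq_zero (mem_generatedRep Ω) (hΩ.primitive hr 1)
  obtain ⟨m, rfl⟩ := Nat.exists_eq_add_of_lt hk
  rw [divPow, LinearMap.smul_apply, show r + m + 1 = m + (r + 1) by ring, pow_add,
    Module.End.mul_apply, h, map_zero, smul_zero]

lemma IsHighestWeightVector.lam_ne_zero (hΩ : IsHighestWeightVector Ω)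
    [FiniteDimensional ℂ (generatedRep Ω)] (hr : ⁅hCartan 0, Ω⁆ = (r : ℂ) • Ω) {c : ℂ}
    (hc : divPow V (xPos 0) r (divPow V (xNeg 1) r Ω) = c • Ω) : c ≠ 0 := by
  rintro rfl
  apply hΩ.pow_pow_ne_zero hr
  have h : ((r.factorial : ℂ)⁻¹) ≠ 0 := inv_ne_zero (Nat.cast_ne_zero.2 r.factorial_ne_zero)
  rw [zero_smul, divPow, divPow, LinearMap.smul_apply, LinearMap.smul_apply, map_smul, smul_smul,
    smul_eq_zero] at hc
  exact hc.resolve_left (mul_ne_zero h h)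

lemma IsHighestWeightVector.natDegree_eq (hΩ : IsHighestWeightVector Ω)
    [FiniteDimensional ℂ (generatedRep Ω)] (hr : ⁅hCartan 0, Ω⁆ = (r : ℂ) • Ω)
    {P : Polynomial ℂ} (hP : IsDrinfeldPolynomial Ω r P) : P.natDegree = r := by
  obtain ⟨lam, hlam, rfl⟩ := hP
  refine le_antisymm (Polynomial.natDegree_le_iff_coeff_eq_zero.2 fun n hn => ?_)
    (Polynomial.le_natDegree_of_ne_zero ?_)
  · rw [coeff_sum_C_mul_neg_X_pow, if_neg (by omega)]
  · rw [coeff_sum_C_mul_neg_X_pow, if_pos le_rfl]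
    exact mul_ne_zero (pow_ne_zero _ (by norm_num)) (hΩ.lam_ne_zero hr (hlam r le_rfl))

/-- If the Drinfeld polynomial is `∏_j (1 - a_j u)`, then `∏_j (t - a_j) ⊗ f` annihilates `Ω`
and `p ⊗ h` acts on `Ω` by `∑_j p(a_j)`. -/
lemma IsHighestWeightVector.parameters (hΩ : IsHighestWeightVector Ω)
    [FiniteDimensional ℂ (generatedRep Ω)] (hr : ⁅hCartan 0, Ω⁆ = (r : ℂ) • Ω)
    (hP : IsDrinfeldPolynomial Ω r (∏ j, (1 - Polynomial.C (u j : ℂ) * Polynomial.X))) :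
    r = s ∧ ⁅neg (Polynomial.toLaurent (nodal u)), Ω⁆ = 0 ∧
      ∀ p, ⁅cartan p, Ω⁆ = (∑ j, ev (u j) p) • Ω := by
  have hs : r = s := by
    rw [← hΩ.natDegree_eq hr hP]
    exact natDegree_prod_one_sub fun j => (u j).ne_zero
  subst hs
  obtain ⟨lam', hlam', hP'⟩ := hP
  obtain ⟨lam, hlam⟩ := exists_divPow_divPow_eq_smul hΩ
  have hll : ∀ k ≤ r, lam' k = lam k := fun k hk =>
    smul_left_injective ℂ hΩ.ne_zero ((hlam' k hk).symm.trans (hlam k))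
  have hsum : ∑ k ∈ Finset.range (r + 1), Polynomial.C (lam' k) * (-Polynomial.X) ^ k =
      ∑ k ∈ Finset.range (r + 1), Polynomial.C (lam k) * (-Polynomial.X) ^ k :=
    Finset.sum_congr rfl fun k hk => by rw [hll k (Nat.lt_succ_iff.1 (Finset.mem_range.1 hk))]
  rw [hsum] at hP'
  choose d hd using hΩ.eigenvector
  have hg : ⁅neg (Polynomial.toLaurent (nodal u)), Ω⁆ = 0 := by
    have h1 := divPow_divPow_succ_eq hΩ hd hlam r
    rw [hΩ.divPow_xNeg_eq_zero hr (Nat.lt_succ_self r), map_zero] at h1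
    -- `garland lam r` is `T 1` times `nodal u` up to sign; multiplying by `T (-1)` removes the
    -- surplus factor.
    have h2 := hΩ.neg_mul_lie h1.symm (T (-1))
    rw [garland_eq_invert, ← hP', mul_smul_comm, ← mul_assoc, ← T_add, show (-1 : ℤ) + (r + 1) = r by ring,
      ← toLaurent_nodal, map_smul, loop_smul_lie] at h2
    exact (smul_eq_zero.1 h2).resolve_left (pow_ne_zero _ (by norm_num))
  refine ⟨rfl, hg, hΩ.cartan_lie_eq hg ?_⟩
  intro n
  obtain _ | n := n
  · simpa using hr
  -- `P` only records `λ_k` for `k ≤ r`; the identity of power series needs the remaining ones to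
  -- vanish.
  have hzero : ∀ k, r < k → lam k = 0 := fun k hk => by
    have h := hlam k
    rw [hΩ.divPow_xNeg_eq_zero hr hk, map_zero] at h
    exact (smul_eq_zero.1 h.symm).resolve_right hΩ.ne_zero
  have hser : (PowerSeries.mk fun n => (-1) ^ n * lam n) =
      ∏ k, (1 - PowerSeries.C (u k : ℂ) * PowerSeries.X) := by
    have h1 : ((∏ j, (1 - Polynomial.C (u j : ℂ) * Polynomial.X) : Polynomial ℂ) :
        PowerSeries ℂ) = ∏ k, (1 - PowerSeries.C (u k : ℂ) * PowerSeries.X) := by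
      rw [← Polynomial.coeToPowerSeries.ringHom_apply, map_prod]
      simp
    rw [← h1, hP']
    ext n
    rw [PowerSeries.coeff_mk, Polynomial.coeff_coe, coeff_sum_C_mul_neg_X_pow]
    split_ifs with h
    · rfl
    · rw [hzero n (by omega), mul_zero]
  have h := eq_power_sum (newton_recursion hΩ hd hlam) hser n
  rw [← h, ← hd]
  push_cast
  rw [add_comm]

end Parameters

section Nodal

open Polynomial

variable {s : ℕ}

lemma xNegParam_eq (A : Multiset ℂ) :
    xNegParam A = neg (toLaurent (A.map fun c => X - C c).prod) := by
  rw [Multiset.prod_X_sub_X_eq_sum_esymm, map_sum, map_sum, xNegParam]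
  refine Finset.sum_congr rfl fun k hk => ?_
  have hk' : k ≤ Multiset.card A := Nat.lt_succ_iff.1 (Finset.mem_range.1 hk)
  have h : ((-1) ^ k * (C (A.esymm k) * X ^ (Multiset.card A - k)) : ℂ[X]) =
      C ((-1) ^ k * A.esymm k) * X ^ (Multiset.card A - k) := by
    rw [C_mul, C_pow, C_neg, C_1, mul_assoc]
  rw [h, toLaurent_C_mul_X_pow, ← LaurentPolynomial.smul_eq_C_mul, map_smul, neg_T,
    Nat.cast_sub hk']

/-- The Laurent polynomial `∏_{i ≠ j} (t - a_i)`. -/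
def cofactor (u : Fin s → ℂˣ) (j : Fin s) : ℂ[T;T⁻¹] :=
  toLaurent (∏ i ∈ Finset.univ.erase j, (X - C (u i : ℂ)))

lemma rho_eq (u : Fin s → ℂˣ) (j : Fin s) :
    rho (fun i => (u i : ℂ)) j = neg (cofactor u j) := by
  rw [rho, xNegParam_eq, Multiset.map_map]
  rfl

lemma ev_cofactor_of_ne (u : Fin s → ℂˣ) {i j : Fin s} (h : i ≠ j) :
    ev (u i) (cofactor u j) = 0 := by
  rw [cofactor, ev_toLaurent, eval_prod]
  exact Finset.prod_eq_zero (Finset.mem_erase.2 ⟨h, Finset.mem_univ i⟩) (by simp)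

lemma ev_cofactor_self {u : Fin s → ℂˣ} (hu : Function.Injective u) (j : Fin s) :
    ev (u j) (cofactor u j) ≠ 0 := by
  rw [cofactor, ev_toLaurent, eval_prod, Finset.prod_ne_zero_iff]
  intro i hi
  rw [eval_sub, eval_X, eval_C, sub_ne_zero]
  exact fun h => (Finset.mem_erase.1 hi).1 (hu (Units.ext h.symm))

end Nodal

/-! ### Products of the operators `ρ_j`: relations -/

section Products

variable {V : Type*} [AddCommGroup V] [Module ℂ V] [LieRingModule L V] [LieModule ℂ L V]
variable {Ω : V} {s : ℕ} {u : Fin s → ℂˣ}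

/-- The vector `ρ_{j_1} ⋯ ρ_{j_n} Ω` for a list `j_1, …, j_n`. -/
def rhoList (Ω : V) (u : Fin s → ℂˣ) : List (Fin s) → V
  | [] => Ω
  | j :: l => ⁅neg (cofactor u j), rhoList Ω u l⁆

lemma rhoVector_eq (Ω : V) (u : Fin s → ℂˣ) {n : ℕ} (j : Fin n → Fin s) :
    rhoVector Ω (fun i => (u i : ℂ)) j = rhoList Ω u (List.ofFn j) := by
  have h (l : List (Fin s)) :
      (l.map fun i => LieModule.toEnd ℂ L V (rho (fun i => (u i : ℂ)) i)).prod Ω =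
        rhoList Ω u l := by
    induction l with
    | nil => rfl
    | cons i l ih =>
      rw [List.map_cons, List.prod_cons, Module.End.mul_apply, ih, LieModule.toEnd_apply_apply,
        rho_eq, rhoList]
  rw [← h, List.map_ofFn]
  rfl

lemma rhoList_perm {l l' : List (Fin s)} (h : l.Perm l') : rhoList Ω u l = rhoList Ω u l' := by
  induction h with
  | nil => rfl
  | cons x _ ih => rw [rhoList, rhoList, ih]
  | swap x y l => simp only [rhoList]; rw [neg_neg_lie]
  | trans _ _ ih₁ ih₂ => rw [ih₁, ih₂]

lemma rhoList_mem_generatedRep (l : List (Fin s)) : rhoList Ω u l ∈ generatedRep Ω := by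
  induction l with
  | nil => exact mem_generatedRep Ω
  | cons j l ih => exact (generatedRep Ω).lie_mem ih

/-- `a_1, …, a_s` are distinct, `∏_j (t - a_j) ⊗ f` annihilates the highest weight vector `Ω`, and
`p ⊗ h` acts on `Ω` by `∑_j p(a_j)`. -/
structure HasSimpleParameters (Ω : V) (u : Fin s → ℂˣ) : Prop where
  highest : IsHighestWeightVector Ω
  injective : Function.Injective u
  nodal_lie : ⁅neg (Polynomial.toLaurent (nodal u)), Ω⁆ = 0
  cartan_lie : ∀ p, ⁅cartan p, Ω⁆ = (∑ j, ev (u j) p) • Ω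

namespace HasSimpleParameters

variable (H : HasSimpleParameters Ω u)
include H

/-- Distinctness of the parameters makes such a `p` a multiple of `nodal u`; lowering operators
commute, so annihilating `Ω` suffices. -/
lemma neg_lie_eq_zero {p : ℂ[T;T⁻¹]} (hp : ∀ j, ev (u j) p = 0) (l : List (Fin s)) :
    ⁅neg p, rhoList Ω u l⁆ = 0 := by
  induction l with
  | nil =>
    obtain ⟨q, rfl⟩ := toLaurent_nodal_dvd H.injective hp
    rw [mul_comm]
    exact H.highest.neg_mul_lie H.nodal_lie q
  | cons j l ih => rw [rhoList, neg_neg_lie, ih, lie_zero]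

lemma neg_lie_congr {p q : ℂ[T;T⁻¹]} (h : ∀ j, ev (u j) p = ev (u j) q) (l : List (Fin s)) :
    ⁅neg p, rhoList Ω u l⁆ = ⁅neg q, rhoList Ω u l⁆ := by
  rw [← sub_eq_zero, ← sub_lie, ← map_sub]
  exact H.neg_lie_eq_zero (fun j => by rw [map_sub, h, sub_self]) l

lemma cartan_lie_rhoList (p : ℂ[T;T⁻¹]) (l : List (Fin s)) :
    ⁅cartan p, rhoList Ω u l⁆ =
      (∑ j, ev (u j) p - 2 * (l.map fun j => ev (u j) p).sum) • rhoList Ω u l := by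
  induction l with
  | nil => simp [rhoList, H.cartan_lie]
  | cons j l ih =>
    have h : ⁅neg (p * cofactor u j), rhoList Ω u l⁆ =
        ev (u j) p • ⁅neg (cofactor u j), rhoList Ω u l⁆ := by
      rw [← loop_smul_lie, ← map_smul]
      refine H.neg_lie_congr (fun i => ?_) l
      rw [map_mul, map_smul, smul_eq_mul]
      by_cases hij : i = j
      · rw [hij]
      · rw [ev_cofactor_of_ne u hij, mul_zero, mul_zero]
    rw [rhoList, cartan_neg_lie, ih, h, lie_smul, List.map_cons, List.sum_cons]
    module

/-- Lagrange interpolation: `p` agrees at all parameters with a combination of cofactors. -/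
lemma neg_lie_rhoList (p : ℂ[T;T⁻¹]) (l : List (Fin s)) :
    ⁅neg p, rhoList Ω u l⁆ =
      ∑ j, (ev (u j) p / ev (u j) (cofactor u j)) • rhoList Ω u (j :: l) := by
  have h : ⁅neg p, rhoList Ω u l⁆ =
      ⁅neg (∑ j, (ev (u j) p / ev (u j) (cofactor u j)) • cofactor u j), rhoList Ω u l⁆ := by
    refine H.neg_lie_congr (fun i => ?_) l
    rw [map_sum, Finset.sum_eq_single i]
    · rw [map_smul, smul_eq_mul, div_mul_cancel₀ _ (ev_cofactor_self H.injective i)]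
    · intro j _ hj
      rw [map_smul, ev_cofactor_of_ne u hj.symm, smul_zero]
    · simp
  rw [h, map_sum, sum_lie]
  refine Finset.sum_congr rfl fun j _ => ?_
  rw [map_smul, loop_smul_lie, rhoList]

/-- The factor `1 - 2 * l.count j` is the weight of `rhoList Ω u l` for the `j`-th copy of `sl₂`: it
starts at 1 and each `ρ_j` lowers it by 2. -/
lemma pos_lie_rhoList_cons (p : ℂ[T;T⁻¹]) (j : Fin s) (l : List (Fin s)) :
    ⁅pos p, rhoList Ω u (j :: l)⁆ =
      (ev (u j) p * ev (u j) (cofactor u j) * (1 - 2 * (l.count j : ℂ))) • rhoList Ω u l +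
        ⁅neg (cofactor u j), ⁅pos p, rhoList Ω u l⁆⁆ := by
  have h1 : ∑ i, ev (u i) (p * cofactor u j) = ev (u j) p * ev (u j) (cofactor u j) := by
    rw [Finset.sum_eq_single j, map_mul]
    · intro i _ hi
      rw [map_mul, ev_cofactor_of_ne u hi, mul_zero]
    · simp
  have h2 : (l.map fun i => ev (u i) (p * cofactor u j)).sum =
      l.count j * (ev (u j) p * ev (u j) (cofactor u j)) := by
    induction l with
    | nil => simp
    | cons i l ih =>
      rw [List.map_cons, List.sum_cons, ih]
      by_cases hij : i = j
      · subst hij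
        rw [List.count_cons_self, map_mul]
        push_cast
        ring
      · rw [List.count_cons_of_ne hij, map_mul, ev_cofactor_of_ne u hij, mul_zero, zero_add]
  rw [rhoList, pos_neg_lie, H.cartan_lie_rhoList, h1, h2]
  congr 2
  ring

lemma rhoList_mem_weightSpace (l : List (Fin s)) :
    rhoList Ω u l ∈ weightSpace V ((s : ℂ) - 2 * (l.length : ℂ)) := by
  have h := H.cartan_lie_rhoList (T 0) l
  rw [cartan_T] at h
  rw [mem_weightSpace, h]
  simp [mul_comm]

lemma pos_one_lie_replicate (j : Fin s) (n : ℕ) :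
    ⁅pos 1, rhoList Ω u (List.replicate (n + 1) j)⁆ =
      (ev (u j) (cofactor u j) * (((n : ℂ) + 1) * (1 - n))) •
        rhoList Ω u (List.replicate n j) := by
  induction n with
  | zero =>
    rw [List.replicate_succ, H.pos_lie_rhoList_cons]
    simp [rhoList, H.highest.pos_lie]
  | succ n ih =>
    rw [List.replicate_succ, H.pos_lie_rhoList_cons, ih, lie_smul, List.count_replicate_self,
      List.replicate_succ, rhoList, map_one]
    push_cast
    module

lemma rhoList_pair_eq_zero [FiniteDimensional ℂ (generatedRep Ω)] (j : Fin s) :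
    rhoList Ω u [j, j] = 0 := by
  have hex : ∃ n, rhoList Ω u (List.replicate n j) = 0 := by
    have : FiniteDimensional ℂ (generatedRep Ω).toSubmodule := ‹_›
    refine exists_eq_zero_of_injective_weights (W := (generatedRep Ω).toSubmodule)
      (μ := fun n : ℕ => (s : ℂ) - 2 * n) (fun n => rhoList_mem_generatedRep _) ?_ ?_
    · intro m n hmn
      simpa using hmn
    · intro n
      simpa using H.rhoList_mem_weightSpace (List.replicate n j)
  -- If `ρ_j^n Ω` is the last nonzero power, raising `ρ_j^{n+1} Ω = 0` forces `(n + 1)(1 - n) = 0`,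
  -- hence `n = 1`.
  obtain ⟨n, hn, hn'⟩ := Nat.exists_not_and_succ_of_not_zero_of_exists
    (by simpa [rhoList] using H.highest.ne_zero) hex
  have h := H.pos_one_lie_replicate j n
  rw [hn', lie_zero, eq_comm, smul_eq_zero] at h
  have h1 := (mul_eq_zero.1 (h.resolve_right hn)).resolve_left (ev_cofactor_self H.injective j)
  have h2 := (mul_eq_zero.1 h1).resolve_left (Nat.cast_add_one_ne_zero n)
  have h3 : n = 1 := by
    have : (n : ℂ) = (1 : ℕ) := by rw [Nat.cast_one]; linear_combination -h2
    exact Nat.cast_injective this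
  subst h3
  exact hn'

lemma rhoList_eq_zero [FiniteDimensional ℂ (generatedRep Ω)] {l : List (Fin s)}
    (hl : ¬ l.Nodup) : rhoList Ω u l = 0 := by
  obtain ⟨j, hj⟩ : ∃ j, [j, j].Sublist l := by
    by_contra! h
    exact hl (List.nodup_iff_sublist.2 h)
  obtain ⟨l', hl'⟩ := hj.exists_perm_append
  rw [rhoList_perm (hl'.trans List.perm_append_comm)]
  clear hl' hj hl
  induction l' with
  | nil => exact H.rhoList_pair_eq_zero j
  | cons i l' ih => rw [List.cons_append, rhoList, ih, lie_zero]

lemma pos_cofactor_lie_of_notMem {l : List (Fin s)} {k : Fin s} (hk : k ∉ l) :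
    ⁅pos (cofactor u k), rhoList Ω u l⁆ = 0 := by
  induction l with
  | nil => exact H.highest.pos_lie _
  | cons j l ih =>
    rw [List.mem_cons, not_or] at hk
    rw [H.pos_lie_rhoList_cons, ih hk.2, lie_zero, ev_cofactor_of_ne u (Ne.symm hk.1)]
    simp

lemma pos_cofactor_lie_of_mem {l : List (Fin s)} (hl : l.Nodup) {k : Fin s} (hk : k ∈ l) :
    ⁅pos (cofactor u k), rhoList Ω u l⁆ =
      (ev (u k) (cofactor u k) ^ 2) • rhoList Ω u (l.erase k) := by
  induction l with
  | nil => simp at hk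
  | cons j l ih =>
    rw [List.nodup_cons] at hl
    rw [H.pos_lie_rhoList_cons, List.count_eq_zero_of_not_mem hl.1]
    by_cases hjk : j = k
    · subst hjk
      rw [H.pos_cofactor_lie_of_notMem hl.1, List.erase_cons_head]
      simp [sq]
    · have hk' : k ∈ l := (List.mem_cons.1 hk).resolve_left (Ne.symm hjk)
      rw [ih hl.2 hk', ev_cofactor_of_ne u hjk, List.erase_cons_tail (by simpa using hjk), rhoList,
        lie_smul]
      simp

end HasSimpleParameters

/-! ### Linear independence and spanning of the sectors -/

/-- The product of the raising operators `∏_{i ≠ k} (t - a_i) ⊗ e` over a list of indices `k`. -/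
def raise (V : Type*) [AddCommGroup V] [Module ℂ V] [LieRingModule L V] [LieModule ℂ L V]
    (u : Fin s → ℂˣ) : List (Fin s) → Module.End ℂ V
  | [] => 1
  | k :: m => raise V u m * LieModule.toEnd ℂ L V (pos (cofactor u k))

lemma raise_cons (k : Fin s) (m : List (Fin s)) (v : V) :
    raise V u (k :: m) v = raise V u m ⁅pos (cofactor u k), v⁆ := rfl

namespace HasSimpleParameters

variable (H : HasSimpleParameters Ω u)
include H

lemma raise_eq_zero {l m : List (Fin s)} (hl : l.Nodup) {k : Fin s} (hm : k ∈ m) (hk : k ∉ l) :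
    raise V u m (rhoList Ω u l) = 0 := by
  induction m generalizing l with
  | nil => simp at hm
  | cons i m ih =>
    rw [raise_cons]
    by_cases hi : i ∈ l
    · rw [H.pos_cofactor_lie_of_mem hl hi, map_smul]
      have hkm : k ∈ m := (List.mem_cons.1 hm).resolve_left fun h => hk (h ▸ hi)
      rw [ih (hl.erase i) hkm fun h => hk (List.mem_of_mem_erase h), smul_zero]
    · rw [H.pos_cofactor_lie_of_notMem hi, map_zero]

lemma raise_self_ne_zero {l m : List (Fin s)} (hl : l.Nodup) (h : m.Perm l) :
    raise V u m (rhoList Ω u l) ≠ 0 := by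
  induction m generalizing l with
  | nil =>
    rw [List.nil_perm.1 h]
    exact H.highest.ne_zero
  | cons i m ih =>
    have hi : i ∈ l := h.subset List.mem_cons_self
    rw [raise_cons, H.pos_cofactor_lie_of_mem hl hi, map_smul]
    refine smul_ne_zero (pow_ne_zero _ (ev_cofactor_self H.injective i)) (ih (hl.erase i) ?_)
    simpa using h.erase i

/-- The operators `raise` act as dual functionals: the one indexed by `i` kills every product whose
index set misses an element of `i`. Index sets of equal size `n` always differ in this way unless
they are equal. -/
lemma linearIndependent (n : ℕ) :
    LinearIndependent ℂ fun j : {j : Fin n → Fin s // StrictMono j} =>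
      rhoList Ω u (List.ofFn j.1) := by
  rw [linearIndependent_iff']
  intro S c hc i hi
  have h := congrArg (raise V u (List.ofFn i.1)) hc
  rw [map_zero, map_sum, Finset.sum_eq_single i] at h
  · rw [map_smul, smul_eq_zero] at h
    exact h.resolve_right (H.raise_self_ne_zero (List.nodup_ofFn.2 i.2.injective) (.refl _))
  · intro j _ hji
    obtain ⟨t, ht⟩ : ∃ t, i.1 t ∉ Set.range j.1 := by
      by_contra! hsub
      apply hji
      have hsub' : Set.range i.1 ⊆ Set.range j.1 := by
        rintro _ ⟨t, rfl⟩
        exact hsub t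
      have heq : Set.range i.1 = Set.range j.1 := by
        refine Set.eq_of_subset_of_ncard_le hsub' ?_ (Set.toFinite _)
        rw [Set.ncard_range_of_injective i.2.injective, Set.ncard_range_of_injective j.2.injective]
      exact Subtype.ext ((j.2.range_inj i.2).1 heq.symm)
    rw [map_smul, H.raise_eq_zero (List.nodup_ofFn.2 j.2.injective) (k := i.1 t), smul_zero]
    · exact List.mem_ofFn.2 ⟨t, rfl⟩
    · rw [List.mem_ofFn]
      exact ht
  · exact fun h => absurd hi h

lemma rhoList_mem_span [FiniteDimensional ℂ (generatedRep Ω)] (l : List (Fin s)) :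
    rhoList Ω u l ∈ Submodule.span ℂ
      (Set.range fun j : {j : Fin l.length → Fin s // StrictMono j} =>
        rhoList Ω u (List.ofFn j.1)) := by
  by_cases hl : l.Nodup
  · have hcard : l.toFinset.card = l.length := List.toFinset_card_of_nodup hl
    let j := l.toFinset.orderEmbOfFin hcard
    refine Submodule.subset_span ⟨⟨j, j.strictMono⟩, rhoList_perm ?_⟩
    refine List.perm_of_nodup_nodup_toFinset_eq (List.nodup_ofFn.2 j.injective) hl ?_
    ext x
    have h := Set.ext_iff.1 (Finset.range_orderEmbOfFin l.toFinset hcard) x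
    rw [List.mem_toFinset, List.mem_ofFn]
    exact h
  · rw [H.rhoList_eq_zero hl]
    exact zero_mem _

lemma generatedRep_le_iSup :
    (generatedRep Ω).toSubmodule ≤
      ⨆ n : ℕ, Submodule.span ℂ {v | ∃ l : List (Fin s), l.length = n ∧ rhoList Ω u l = v} := by
  set N : ℕ → Submodule ℂ V := fun n =>
    Submodule.span ℂ {v | ∃ l : List (Fin s), l.length = n ∧ rhoList Ω u l = v} with hN
  have hmem (l : List (Fin s)) : rhoList Ω u l ∈ ⨆ n, N n :=
    Submodule.mem_iSup_of_mem l.length (Submodule.subset_span ⟨l, rfl, rfl⟩)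
  have hle : Submodule.span ℂ (Set.range (rhoList Ω u)) ≤ ⨆ n, N n := by
    rw [Submodule.span_le]
    rintro _ ⟨l, rfl⟩
    exact hmem l
  refine le_trans (H.highest.generatedRep_le
    (N := Submodule.span ℂ (Set.range (rhoList Ω u))) (Submodule.subset_span ⟨[], rfl⟩) ?_) hle
  intro p v hv
  induction hv using Submodule.span_induction with
  | mem v hv =>
    obtain ⟨l, rfl⟩ := hv
    rw [H.neg_lie_rhoList]
    exact Submodule.sum_mem _ fun j _ => Submodule.smul_mem _ _ (Submodule.subset_span ⟨_, rfl⟩)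
  | zero => simp
  | add v w _ _ hv hw => rw [lie_add]; exact add_mem hv hw
  | smul c v _ hv => rw [lie_smul]; exact Submodule.smul_mem _ c hv

lemma span_eq_sector [FiniteDimensional ℂ (generatedRep Ω)] (n : ℕ) :
    Submodule.span ℂ (Set.range fun j : {j : Fin n → Fin s // StrictMono j} =>
      rhoList Ω u (List.ofFn j.1)) = sector Ω ((s : ℂ) - 2 * (n : ℂ)) := by
  apply le_antisymm
  · rw [Submodule.span_le]
    rintro _ ⟨j, rfl⟩
    refine ⟨rhoList_mem_generatedRep _, ?_⟩
    simpa using H.rhoList_mem_weightSpace (List.ofFn j.1)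
  · rintro v ⟨hv, hvn⟩
    set N : ℕ → Submodule ℂ V := fun n =>
      Submodule.span ℂ {v | ∃ l : List (Fin s), l.length = n ∧ rhoList Ω u l = v} with hN
    have hNw (m : ℕ) : N m ≤ weightSpace V ((s : ℂ) - 2 * m) := by
      rw [hN, Submodule.span_le]
      rintro _ ⟨l, rfl, rfl⟩
      exact H.rhoList_mem_weightSpace l
    -- Split `v` into its part in `N n` and a part `y` from other lengths; `y` has the weight of the
    -- sector yet lies in the sum of the other weight spaces, so it vanishes.
    have h1 : v ∈ N n ⊔ ⨆ m, ⨆ (_ : m ≠ n), N m := by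
      rw [← iSup_split_single]
      exact H.generatedRep_le_iSup hv
    obtain ⟨x, hx, y, hy, rfl⟩ := Submodule.mem_sup.1 h1
    have hyn : y ∈ weightSpace V ((s : ℂ) - 2 * n) := by
      have := sub_mem hvn (hNw n hx)
      rwa [add_sub_cancel_left] at this
    have hy' : y ∈ ⨆ μ, ⨆ (_ : μ ≠ (s : ℂ) - 2 * n), weightSpace V μ := by
      have hle : ⨆ m, ⨆ (_ : m ≠ n), N m ≤
          ⨆ μ, ⨆ (_ : μ ≠ (s : ℂ) - 2 * n), weightSpace V μ := by
        refine iSup₂_le fun m hm => (hNw m).trans ?_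
        exact le_iSup₂_of_le ((s : ℂ) - 2 * m) (fun h => hm (by simpa using h)) le_rfl
      exact hle hy
    have hdis := Module.End.eigenspaces_iSupIndep (LieModule.toEnd ℂ L V (hCartan 0))
      ((s : ℂ) - 2 * n)
    rw [Submodule.disjoint_def.1 hdis y hyn hy', add_zero]
    have hle : N n ≤ Submodule.span ℂ
        (Set.range fun j : {j : Fin n → Fin s // StrictMono j} =>
          rhoList Ω u (List.ofFn j.1)) := by
      rw [hN, Submodule.span_le]
      rintro _ ⟨l, rfl, rfl⟩
      exact H.rhoList_mem_span l
    exact hle hx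

end HasSimpleParameters

end Products

end SlTwoLoop

end

open SlTwoLoop in
theorem mainTheorem2 {V : Type*} [AddCommGroup V] [Module ℂ V]
    [LieRingModule SlTwoLoop.L V] [LieModule ℂ SlTwoLoop.L V]
    (Ω : V) (hΩ : IsHighestWeightVector Ω)
    (hfin : FiniteDimensional ℂ (generatedRep Ω)) :
    -- the weight `r` is a natural number and the Drinfeld polynomial exists, of degree `r`
    (∃ (r : ℕ) (P : Polynomial ℂ), ⁅hCartan 0, Ω⁆ = (r : ℂ) • Ω ∧
      IsDrinfeldPolynomial Ω r P ∧ P.natDegree = r) ∧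
    ∀ (r : ℕ) (P : Polynomial ℂ), ⁅hCartan 0, Ω⁆ = (r : ℂ) • Ω → IsDrinfeldPolynomial Ω r P →
      ∀ (s : ℕ) (a : Fin s → ℂ) (m : Fin s → ℕ), IsEvaluationParameters P a m →
        (∀ k, m k = 1) →
        ∀ n : ℕ,
          LinearIndependent ℂ
            (fun j : {j : Fin n → Fin s // StrictMono j} => rhoVector Ω a j.1) ∧
          Submodule.span ℂ
            (Set.range fun j : {j : Fin n → Fin s // StrictMono j} => rhoVector Ω a j.1) =
              sector Ω ((r : ℂ) - 2 * (n : ℂ)) ∧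
          ∀ j : Fin n → Fin s, Monotone j → ¬ StrictMono j → rhoVector Ω a j = 0 := by
  constructor
  · obtain ⟨r, hr⟩ := hΩ.exists_weight
    obtain ⟨lam, hlam⟩ := exists_divPow_divPow_eq_smul hΩ
    have hP : IsDrinfeldPolynomial Ω r
        (∑ k ∈ Finset.range (r + 1), Polynomial.C (lam k) * (-Polynomial.X) ^ k) :=
      ⟨lam, fun k _ => hlam k, rfl⟩
    exact ⟨r, _, hr, hP, hΩ.natDegree_eq hr hP⟩
  · intro r P hr hP s a m ha hm n
    obtain ⟨u, rfl⟩ : ∃ u : Fin s → ℂˣ, a = fun i => (u i : ℂ) :=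
      ⟨fun i => Units.mk0 (a i) (ha.ne_zero i), rfl⟩
    have hfac := ha.factorization
    simp only [hm, pow_one] at hfac
    subst hfac
    obtain ⟨rfl, hg, hc⟩ := hΩ.parameters hr hP
    have H : HasSimpleParameters Ω u :=
      ⟨hΩ, fun i j h => ha.injective (congrArg Units.val h), hg, hc⟩
    simp only [rhoVector_eq]
    refine ⟨H.linearIndependent n, H.span_eq_sector n, fun j hj hj' => H.rhoList_eq_zero ?_⟩
    rw [List.nodup_ofFn]
    exact fun hinj => hj' (hj.strictMono_of_injective hinj)
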